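/- Let $d\in\mathbb{N}$, $\alpha_0\in(0,2)$ and $C_U>0$. For $\alpha\in[\alpha_0,2)$, an open set $D\subset\mathbb{R}^d$ and a measurable $u:D\to\mathbb{R}$ put $$\mathcal{E}^{\mu_\alpha}_D(u,u)=(2-\alpha)\int_D\int_D\frac{(u(y)-u(x))^2}{|x-y|^{d+\alpha}}\,dy\,dx ,$$ and let $H^{\alpha/2}(D)$ be the set of all $u\in L^2(D)$ with $\mathcal{E}^{\mu_\alpha}_D(u,u)<\infty$. For a Borel measure $\nu$ on $\mathbb{R}^d$ with $\nu(\{0\})=0$ put $$\mathcal{E}^{\nu}_D(u,u)=\int_D\int_{\mathbb{R}^d}\big(u(x)-u(x+z)\big)^2\,\mathbf{1}_D(x+z)\,\nu(dz)\,dx .$$ Say that $\nu$ satisfies (U) with exponent $\alpha$ and constant $C_U$ if $$\int_{\mathbb{R}^d}(r\wedge|z|)^2\,\nu(dz)\le C_U\,r^{2-\alpha}\qquad\text{for all } 0<r\le 1 .$$ (i) For every bounded Lipschitz domain $D\subset\mathbb{R}^d$ there is a constant $c=c(\alpha_0,d,C_U,D)<\infty$ such that for every $\alpha\in[\alpha_0,2)$,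 every Borel measure $\nu$ with $\nu(\{0\})=0$ satisfying (U) with exponent $\alpha$ and constant $C_U$, and every $u\in H^{\alpha/2}(D)$, $$\mathcal{E}^{\nu}_D(u,u)\le c\,\mathcal{E}^{\mu_\alpha}_D(u,u).$$ (ii) There is a constant $c=c(\alpha_0,d,C_U)<\infty$ such that this inequality holds for all balls $D=B_r(x_0)$ with $x_0\in\mathbb{R}^d$ and $0<r<1$, all $\alpha\in[\alpha_0,2)$, all such $\nu$ and all $u\in H^{\alpha/2}(D)$. Here a Lipschitz domain is a non-empty connected open set which, in a small ball around each of its boundary points and in suitable Cartesian coordinates, is the set of points strictly above the graph of a Lipschitz function. -/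

import Mathlib

open MeasureTheory
open scoped ENNReal NNReal

namespace NonlocalForms

/-- Euclidean space of dimension `d`. -/
abbrev Rd (d : ℕ) : Type := EuclideanSpace ℝ (Fin d)

/-- A Lipschitz domain: a non-empty connected open set that, near each of its boundary points, is
the part of a small ball strictly above the graph of a Lipschitz function. The graph is taken in
the direction of a unit vector `e` and over the hyperplane orthogonal to `e`; the vector
`y - ⟪e, y⟫ e` is the orthogonal projection of `y` to that hyperplane (and a Lipschitz function on
the hyperplane is the same thing as the restriction of a Lipschitz function on the whole space). -/
structure IsLipschitzDomain {d : ℕ} (D : Set (Rd d)) : Prop where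
  isOpen : IsOpen D
  isConnected : IsConnected D
  boundary_graph : ∀ x ∈ frontier D, ∃ (e : Rd d) (g : Rd d → ℝ) (K : ℝ≥0) (r : ℝ),
    ‖e‖ = 1 ∧ LipschitzWith K g ∧ 0 < r ∧
      ∀ y ∈ Metric.ball x r, y ∈ D ↔ g (y - (inner ℝ e y : ℝ) • e) < (inner ℝ e y : ℝ)

/-- The measures `μ_α(x, dy) = (2 - α) |x - y|^(-d-α) dy`. -/
noncomputable def muAlpha (d : ℕ) (α : ℝ) (x : Rd d) : Measure (Rd d) :=
  volume.withDensity fun y => ENNReal.ofReal ((2 - α) * ‖x - y‖ ^ (-(d : ℝ) - α))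

/-- The quadratic form `∫_D ∫_D (u(y) - u(x))² μ(x, dy) dx` of a family of measures, with values
in `[0, ∞]`. -/
noncomputable def kernelForm {d : ℕ} (μ : Rd d → Measure (Rd d)) (D : Set (Rd d))
    (u : Rd d → ℝ) : ℝ≥0∞ :=
  ∫⁻ x in D, ∫⁻ y in D, ENNReal.ofReal ((u y - u x) ^ 2) ∂(μ x)

/-- The quadratic form `∫_D ∫ (u(x) - u(x+z))² 1_D(x+z) ν(dz) dx` of one measure, with values
in `[0, ∞]`. -/
noncomputable def jumpForm {d : ℕ} (ν : Measure (Rd d)) (D : Set (Rd d))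
    (u : Rd d → ℝ) : ℝ≥0∞ :=
  ∫⁻ x in D, ∫⁻ z, D.indicator (fun y => ENNReal.ofReal ((u x - u y) ^ 2)) (x + z) ∂ν

/-- The space `H^{α/2}(D)`: the functions in `L²(D)` whose `μ_α`-form on `D` is finite. Only the
values of `u` on `D` matter. -/
def MemH {d : ℕ} (α : ℝ) (D : Set (Rd d)) (u : Rd d → ℝ) : Prop :=
  MemLp u 2 (volume.restrict D) ∧ kernelForm (muAlpha d α) D u < ∞

/-- The upper-bound assumption: `∫ (r ∧ |z|)² ν(dz) ≤ C r^(2-α)` for all `0 < r ≤ 1`. -/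
def UpperBound {d : ℕ} (α C : ℝ) (ν : Measure (Rd d)) : Prop :=
  ∀ r : ℝ, 0 < r → r ≤ 1 →
    ∫⁻ z, ENNReal.ofReal ((min r ‖z‖) ^ 2) ∂ν ≤ ENNReal.ofReal (C * r ^ (2 - α))

end NonlocalForms

/-!
The idea is to compare both forms with the squared `L²` moduli of shifts
`F(h) = ∫ (u(x) - u(x + h))² dx`, taken over those `x` with `x, x + h ∈ D` (`increment`). By Tonelli,
`jumpForm ν D u = ∫ F dν`, and the `μ_α`-form is `∫ F(h) (2 - α) |h|^(-d-α) dh`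
(`jumpForm_eq_lintegral_increment`, `kernelForm_muAlpha_eq`). No extension operator and no Fourier
transform is needed: everything rests on three properties of `Φ(ρ) = sup_{|k| ≤ ρ} F(k)`.

* `Φ(ρ) / ρ² ≤ C Φ(s) / s²` for small `s ≤ ρ` (`UniformCone.shiftModulus_le`). Two points of `D` at
  distance of order `ρ` are joined inside `D` by three segments, up along the axis of an interior
  cone, across, and down; each segment is cut into about `ρ / s` equal steps and the Cauchy-Schwarz
  inequality is applied. Translation invariance turns every step into a value of `F`.
* `Φ(ρ) ≤ C ρ^(-d) ∫_{|h| ≤ 3ρ} F(h) dh` for small `ρ` (`UniformCone.shiftModulus_le_average`). This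
  is the triangle inequality, averaged over intermediate points in a ball inside the cone.
* All values of `F` are bounded by a multiple of `Φ` at a fixed small scale. On a ball this follows
  from convexity (`increment_convex`), with a constant that does not depend on the radius; on a
  bounded Lipschitz domain it follows from a nonlocal Poincaré inequality
  (`exists_crossEnergy_self_le`), that is, from connectedness.

Both kinds of domain satisfy the uniform cone condition by compactness
(`IsLipschitzDomain.exists_uniformCone`, `exists_uniformCone_unitBall`), and for balls the condition
scales with the radius.

The comparison itself is `UpperBound.lintegral_le`. The function `|z|² sup_{t ≥ |z|} Φ(t) / t²`
dominates `F(z)` for small `z`, and its second factor is decreasing in `|z|`. The upper-bound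
assumption says that `|z|² ν(dz)` gives to small balls `B_a` at most
`C a^(2-α) = C ∫_0^a (2 - α) s^(1-α) ds`, so the layer-cake formula bounds `∫ F dν` by
`C (2 - α) ∫_0^R Φ(s) s^(-1-α) ds`. Here the factor `2 - α` appears with a constant independent
of `α`. The averaging property and Tonelli's theorem turn this integral into the `μ_α`-form.
-/

namespace NonlocalForms

open Metric Set

variable {d : ℕ}

/-! ### Squared increments and shifts -/

/-- The squared increment `(u x - u y)²` when both points lie in `D`, and `0` otherwise. -/
noncomputable def sqDiff (D : Set (Rd d)) (u : Rd d → ℝ) (x y : Rd d) : ℝ≥0∞ :=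
  (D ×ˢ D).indicator (fun p => ENNReal.ofReal ((u p.1 - u p.2) ^ 2)) (x, y)

/-- The squared `L²` modulus of the shift by `h`, taken over those `x` with `x, x + h ∈ D`. -/
noncomputable def increment (D : Set (Rd d)) (u : Rd d → ℝ) (h : Rd d) : ℝ≥0∞ :=
  ∫⁻ x, sqDiff D u x (x + h)

section SqDiff

variable {D : Set (Rd d)} {u : Rd d → ℝ}

lemma sqDiff_of_mem {x y : Rd d} (hx : x ∈ D) (hy : y ∈ D) :
    sqDiff D u x y = ENNReal.ofReal ((u x - u y) ^ 2) :=
  indicator_of_mem (mk_mem_prod hx hy) _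

lemma sqDiff_of_notMem {x y : Rd d} (h : ¬(x ∈ D ∧ y ∈ D)) : sqDiff D u x y = 0 :=
  indicator_of_notMem (fun hp => h (mem_prod.1 hp)) _

lemma sqDiff_comm (x y : Rd d) : sqDiff D u x y = sqDiff D u y x := by
  by_cases h : x ∈ D ∧ y ∈ D
  · rw [sqDiff_of_mem h.1 h.2, sqDiff_of_mem h.2 h.1, ← neg_sub, neg_sq]
  · rw [sqDiff_of_notMem h, sqDiff_of_notMem (fun h' => h h'.symm)]

lemma measurable_sqDiff (hD : MeasurableSet D) (hu : Measurable u) :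
    Measurable fun p : Rd d × Rd d => sqDiff D u p.1 p.2 := by
  have : Measurable fun p : Rd d × Rd d => ENNReal.ofReal ((u p.1 - u p.2) ^ 2) := by fun_prop
  exact this.indicator (hD.prod hD)

lemma measurable_sqDiff_comp {X : Type*} [MeasurableSpace X] (hD : MeasurableSet D)
    (hu : Measurable u) {f g : X → Rd d} (hf : Measurable f) (hg : Measurable g) :
    Measurable fun x => sqDiff D u (f x) (g x) :=
  (measurable_sqDiff hD hu).comp (hf.prodMk hg)

lemma measurable_increment (hD : MeasurableSet D) (hu : Measurable u) :
    Measurable (increment D u) :=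
  Measurable.lintegral_prod_right'
    (f := fun p : Rd d × Rd d => sqDiff D u p.2 (p.2 + p.1))
    (measurable_sqDiff_comp hD hu measurable_snd (measurable_snd.add measurable_fst))

lemma lintegral_sqDiff_add_add (a b : Rd d) :
    ∫⁻ x, sqDiff D u (x + a) (x + b) = increment D u (b - a) := by
  rw [increment, ← lintegral_add_right_eq_self (fun x => sqDiff D u x (x + (b - a))) a]
  simp only [add_assoc, add_sub_cancel]

/-- The squared increment along a chain of `N` steps in `D`, by the Cauchy-Schwarz inequality. -/
lemma sqDiff_chain (N : ℕ) (p : ℕ → Rd d) (hp : ∀ j ≤ N, p j ∈ D) :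
    sqDiff D u (p 0) (p N) ≤ N * ∑ j ∈ Finset.range N, sqDiff D u (p j) (p (j + 1)) := by
  have h1 : ∀ j ∈ Finset.range N,
      sqDiff D u (p j) (p (j + 1)) = ENNReal.ofReal ((u (p j) - u (p (j + 1))) ^ 2) := by
    intro j hj
    have := Finset.mem_range.1 hj
    exact sqDiff_of_mem (hp _ (by omega)) (hp _ (by omega))
  rw [Finset.sum_congr rfl h1, sqDiff_of_mem (hp _ (Nat.zero_le _)) (hp _ le_rfl),
    ← ENNReal.ofReal_sum_of_nonneg (fun _ _ => sq_nonneg _), ← ENNReal.ofReal_natCast,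
    ← ENNReal.ofReal_mul (Nat.cast_nonneg _), ← Finset.sum_range_sub' (fun j => u (p j))]
  refine ENNReal.ofReal_le_ofReal ?_
  simpa using sq_sum_le_card_mul_sum_sq (s := Finset.range N)
    (f := fun j => u (p j) - u (p (j + 1)))

lemma sqDiff_le_two_mul {x y z : Rd d} (hy : y ∈ D) :
    sqDiff D u x z ≤ 2 * (sqDiff D u x y + sqDiff D u y z) := by
  by_cases h : x ∈ D ∧ z ∈ D
  · have := sqDiff_chain (D := D) (u := u) 2 (fun j => if j = 0 then x else if j = 1 then y else z)
      (by intro j _; split_ifs; exacts [h.1, hy, h.2])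
    simpa [Finset.sum_range_succ] using this
  · simp [sqDiff_of_notMem h]

lemma sqDiff_le_three_mul {x y z w : Rd d} (hx : x ∈ D) (hy : y ∈ D) (hz : z ∈ D) (hw : w ∈ D) :
    sqDiff D u x w ≤ 3 * (sqDiff D u x y + sqDiff D u y z + sqDiff D u z w) := by
  have := sqDiff_chain (D := D) (u := u) 3
    (fun j => if j = 0 then x else if j = 1 then y else if j = 2 then z else w)
    (by intro j _; split_ifs; exacts [hx, hy, hz, hw])
  simpa [Finset.sum_range_succ] using this

/-- The sum of the squared increments along `N` equal steps from `x` to `x + v`. -/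
noncomputable def stepSum (D : Set (Rd d)) (u : Rd d → ℝ) (N : ℕ) (x v : Rd d) : ℝ≥0∞ :=
  ∑ j ∈ Finset.range N, sqDiff D u (x + ((j : ℝ) / N) • v) (x + (((j + 1 : ℕ) : ℝ) / N) • v)

lemma sqDiff_le_stepSum {N : ℕ} (hN : 0 < N) {x v : Rd d}
    (h : ∀ t : ℝ, 0 ≤ t → t ≤ 1 → x + t • v ∈ D) :
    sqDiff D u x (x + v) ≤ N * stepSum D u N x v := by
  have hN' : (0 : ℝ) < N := Nat.cast_pos.2 hN
  have := sqDiff_chain (D := D) (u := u) N (fun j => x + ((j : ℝ) / N) • v) (by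
    intro j hj
    refine h _ (by positivity) ?_
    rw [div_le_one hN']
    exact_mod_cast hj)
  simpa [div_self hN'.ne', stepSum] using this

lemma measurable_stepSum (hD : MeasurableSet D) (hu : Measurable u) (N : ℕ) (a v : Rd d) :
    Measurable fun x => stepSum D u N (x + a) v := by
  refine Finset.measurable_sum _ fun j _ => measurable_sqDiff_comp hD hu ?_ ?_ <;> fun_prop

lemma lintegral_stepSum (hD : MeasurableSet D) (hu : Measurable u) (N : ℕ) (a v : Rd d) :
    ∫⁻ x, stepSum D u N (x + a) v = N * increment D u ((N : ℝ)⁻¹ • v) := by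
  unfold stepSum
  rw [lintegral_finsetSum]
  · have : ∀ j ∈ Finset.range N,
        ∫⁻ x, sqDiff D u (x + a + ((j : ℝ) / N) • v) (x + a + (((j + 1 : ℕ) : ℝ) / N) • v)
          = increment D u ((N : ℝ)⁻¹ • v) := by
      intro j _
      simp only [add_assoc]
      rw [lintegral_sqDiff_add_add]
      congr 1
      rw [add_sub_add_left_eq_sub, ← sub_smul]
      congr 1
      push_cast
      ring
    rw [Finset.sum_congr rfl this]
    simp
  · intro j _
    exact measurable_sqDiff_comp hD hu (by fun_prop) (by fun_prop)

/-- In a convex set the segment between two points may be cut into `N` equal steps. -/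
lemma increment_convex (hD : MeasurableSet D) (hu : Measurable u) (hc : Convex ℝ D) {N : ℕ}
    (hN : 0 < N) (h : Rd d) :
    increment D u h ≤ N ^ 2 * increment D u ((N : ℝ)⁻¹ • h) := by
  calc increment D u h ≤ ∫⁻ x, N * stepSum D u N (x + 0) h := by
        refine lintegral_mono fun x => ?_
        by_cases hx : x ∈ D ∧ x + h ∈ D
        · rw [add_zero]
          refine sqDiff_le_stepSum hN fun t h0 h1 => ?_
          exact hc.add_smul_mem hx.1 hx.2 ⟨h0, h1⟩
        · simp [sqDiff_of_notMem hx]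
    _ = N ^ 2 * increment D u ((N : ℝ)⁻¹ • h) := by
        rw [lintegral_const_mul _ (measurable_stepSum hD hu _ _ _), lintegral_stepSum hD hu, sq,
          mul_assoc]

end SqDiff

/-! ### Shifts on sets with the uniform cone condition -/

/-- The uniform interior cone condition at scale `R` with aperture `δ`, the axes of the cones
being taken from a finite set `E` of vectors of norm at most one: near each point of `D` one single
axis serves all points of `D`. The axis `0` (a small ball) is allowed. -/
def UniformCone (D : Set (Rd d)) (E : Finset (Rd d)) (R δ : ℝ) : Prop :=
  (∀ e ∈ E, ‖e‖ ≤ 1) ∧ ∀ x ∈ D, ∃ e ∈ E, ∀ y ∈ D, dist y x ≤ R →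
    ∀ ρ : ℝ, 0 ≤ ρ → ρ ≤ R → ∀ w : Rd d, ‖w‖ ≤ δ → y + ρ • (e + w) ∈ D

section Cone

variable {D : Set (Rd d)} {u : Rd d → ℝ} {E : Finset (Rd d)} {R δ : ℝ}

/-- The shift by `h` is controlled by shifts that are `N` times smaller: two points of `D` at
distance `|h|` are joined inside `D` by a path of three segments, up along the axis of the cone,
across, and down again, and each segment is cut into `N` equal steps. -/
lemma UniformCone.increment_le (hcone : UniformCone D E R δ) (hD : MeasurableSet D)
    (hu : Measurable u) (hδ : 0 < δ) (hδ1 : δ ≤ 1) {h : Rd d} (hh : ‖h‖ ≤ δ * R) {N : ℕ}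
    (hN : 0 < N) {B : ℝ≥0∞}
    (hB : ∀ k : Rd d, ‖k‖ ≤ ‖h‖ / (δ * N) → increment D u k ≤ B) :
    increment D u h ≤ (9 * E.card * N ^ 2 : ℝ≥0) * B := by
  have hN' : (0 : ℝ) < N := Nat.cast_pos.2 hN
  -- the height at which the cone is wide enough for the horizontal segment to stay inside
  set ρ : ℝ := ‖h‖ / δ with hρ
  have hρ0 : 0 ≤ ρ := by positivity
  have hρR : ρ ≤ R := by rw [hρ, div_le_iff₀ hδ, mul_comm]; exact hh
  have hhρ : ‖h‖ = ρ * δ := by rw [hρ, div_mul_cancel₀ _ hδ.ne']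
  have hhR : ‖h‖ ≤ R := by nlinarith
  have key : ∀ x, sqDiff D u x (x + h) ≤ ∑ e ∈ E, 3 * N * (stepSum D u N (x + 0) (ρ • e) +
      stepSum D u N (x + ρ • e) h + stepSum D u N (x + h) (ρ • e)) := by
    intro x
    by_cases hx : x ∈ D ∧ x + h ∈ D
    swap
    · simp [sqDiff_of_notMem hx]
    obtain ⟨e, he, H⟩ := hcone.2 x hx.1
    have hup : ∀ y ∈ D, dist y x ≤ R → ∀ t : ℝ, 0 ≤ t → t ≤ 1 → y + t • (ρ • e) ∈ D := by
      intro y hy hyx t h0 h1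
      have := H y hy hyx (t * ρ) (by positivity) (by nlinarith) 0 (by simpa using hδ.le)
      simpa [smul_smul] using this
    have hdx : dist x x ≤ R := by rw [dist_self]; exact hρ0.trans hρR
    have hdxh : dist (x + h) x ≤ R := by simpa [dist_eq_norm] using hhR
    have hacross : ∀ t : ℝ, 0 ≤ t → t ≤ 1 → (x + ρ • e) + t • h ∈ D := by
      intro t h0 h1
      rcases hρ0.eq_or_lt with h' | h'
      · have : h = 0 := by rw [← norm_eq_zero, hhρ, ← h', zero_mul]
        simpa [this, ← h'] using hx.1
      · have := H x hx.1 hdx ρ hρ0 hρR ((t / ρ) • h) (by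
          rw [norm_smul, Real.norm_of_nonneg (by positivity), hhρ]
          rw [div_mul_eq_mul_div, div_le_iff₀ h']
          nlinarith [mul_nonneg h'.le hδ.le])
        rw [smul_add, smul_smul, mul_div_cancel₀ _ h'.ne', ← add_assoc] at this
        exact this
    have h1 := sqDiff_le_stepSum (u := u) hN (hup x hx.1 hdx)
    have h2 := sqDiff_le_stepSum (u := u) hN hacross
    have h3 := sqDiff_le_stepSum (u := u) hN (hup (x + h) hx.2 hdxh)
    have hm1 : x + ρ • e ∈ D := by simpa using hup x hx.1 hdx 1 zero_le_one le_rfl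
    have hm2 : x + ρ • e + h ∈ D := by simpa using hacross 1 zero_le_one le_rfl
    have h4 := sqDiff_le_three_mul (u := u) hx.1 hm1 hm2 hx.2
    rw [sqDiff_comm (x + ρ • e + h) (x + h), add_right_comm x (ρ • e) h] at h4
    rw [add_right_comm x (ρ • e) h] at h2
    refine le_trans ?_ (Finset.single_le_sum (f := fun e => 3 * (N : ℝ≥0∞) *
      (stepSum D u N (x + 0) (ρ • e) + stepSum D u N (x + ρ • e) h +
        stepSum D u N (x + h) (ρ • e))) (fun _ _ => zero_le) he)
    rw [add_zero, mul_assoc, mul_add (N : ℝ≥0∞), mul_add (N : ℝ≥0∞)]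
    exact h4.trans (by gcongr)
  have hsmall : ∀ v : Rd d, ‖v‖ ≤ ρ → increment D u ((N : ℝ)⁻¹ • v) ≤ B := by
    intro v hv
    refine hB _ ?_
    rw [norm_smul, norm_inv, Real.norm_of_nonneg hN'.le, ← div_div, ← hρ, inv_mul_eq_div]
    gcongr
  calc increment D u h ≤ ∫⁻ x, ∑ e ∈ E, 3 * N * (stepSum D u N (x + 0) (ρ • e) +
          stepSum D u N (x + ρ • e) h + stepSum D u N (x + h) (ρ • e)) := lintegral_mono key
    _ = ∑ e ∈ E, 3 * N * (N * increment D u ((N : ℝ)⁻¹ • ρ • e) +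
          N * increment D u ((N : ℝ)⁻¹ • h) + N * increment D u ((N : ℝ)⁻¹ • ρ • e)) := by
        have m := measurable_stepSum (D := D) hD hu N
        have m2 : ∀ e, Measurable fun x =>
            stepSum D u N (x + 0) (ρ • e) + stepSum D u N (x + ρ • e) h :=
          fun e => (m _ _).add (m _ _)
        have m3 : ∀ e, Measurable fun x => stepSum D u N (x + 0) (ρ • e) +
            stepSum D u N (x + ρ • e) h + stepSum D u N (x + h) (ρ • e) :=
          fun e => (m2 e).add (m _ _)
        rw [lintegral_finsetSum _ fun e _ => (m3 e).const_mul _]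
        refine Finset.sum_congr rfl fun e _ => ?_
        rw [lintegral_const_mul _ (m3 e), lintegral_add_left (m2 e), lintegral_add_left (m _ _),
          lintegral_stepSum hD hu, lintegral_stepSum hD hu, lintegral_stepSum hD hu]
    _ ≤ ∑ e ∈ E, 3 * N * (N * B + N * B + N * B) := by
        refine Finset.sum_le_sum fun e he => ?_
        have he' : ‖ρ • e‖ ≤ ρ := by
          rw [norm_smul, Real.norm_of_nonneg hρ0]
          exact mul_le_of_le_one_right hρ0 (hcone.1 e he)
        gcongr
        · exact hsmall _ he'
        · exact hsmall _ (by rw [hhρ]; exact mul_le_of_le_one_right hρ0 hδ1)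
        · exact hsmall _ he'
    _ = (9 * E.card * N ^ 2 : ℝ≥0) * B := by
        rw [Finset.sum_const, nsmul_eq_mul]
        push_cast
        ring

/-- A single shift is controlled by the average of all shifts of comparable size: the intermediate
point of the triangle inequality ranges over a ball inside the cone. -/
lemma UniformCone.increment_le_average (hcone : UniformCone D E R δ) (hD : MeasurableSet D)
    (hu : Measurable u) (hδ1 : δ ≤ 1) {k : Rd d} {ρ : ℝ} (hρ : 0 < ρ)
    (hρR : ρ ≤ R) (hk : ‖k‖ ≤ ρ) :
    volume (ball (0 : Rd d) (ρ * δ)) * increment D u k ≤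
      (4 * E.card : ℝ≥0) * ∫⁻ h in closedBall (0 : Rd d) (3 * ρ), increment D u h := by
  have hsub : ∀ e ∈ E, ∀ h ∈ ball (ρ • e) (ρ * δ), ‖h‖ ≤ 2 * ρ := by
    intro e he h hh
    have h1 : ‖h - ρ • e‖ < ρ * δ := by simpa [dist_eq_norm] using hh
    have h2 : ‖ρ • e‖ ≤ ρ := by
      rw [norm_smul, Real.norm_of_nonneg hρ.le]
      exact mul_le_of_le_one_right hρ.le (hcone.1 e he)
    have h3 := norm_le_norm_sub_add h (ρ • e)
    nlinarith
  have m1 : Measurable fun p : Rd d × Rd d =>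
      2 * (sqDiff D u p.1 (p.1 + p.2) + sqDiff D u (p.1 + p.2) (p.1 + k)) :=
    ((measurable_sqDiff_comp hD hu (by fun_prop) (by fun_prop)).add
      (measurable_sqDiff_comp hD hu (by fun_prop) (by fun_prop))).const_mul _
  have key : ∀ x, volume (ball (0 : Rd d) (ρ * δ)) * sqDiff D u x (x + k) ≤
      ∑ e ∈ E, ∫⁻ h in ball (ρ • e) (ρ * δ),
        2 * (sqDiff D u x (x + h) + sqDiff D u (x + h) (x + k)) := by
    intro x
    by_cases hx : x ∈ D ∧ x + k ∈ D
    swap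
    · simp [sqDiff_of_notMem hx]
    obtain ⟨e, he, H⟩ := hcone.2 x hx.1
    refine le_trans ?_ (Finset.single_le_sum (f := fun e => ∫⁻ h in ball (ρ • e) (ρ * δ),
        2 * (sqDiff D u x (x + h) + sqDiff D u (x + h) (x + k))) (fun _ _ => zero_le) he)
    rw [← Measure.addHaar_ball_center volume (ρ • e), mul_comm, ← setLIntegral_const]
    refine setLIntegral_mono' measurableSet_ball fun h hh => sqDiff_le_two_mul ?_
    have := H x hx.1 (by rw [dist_self]; linarith) ρ hρ.le hρR (ρ⁻¹ • (h - ρ • e)) (by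
      rw [norm_smul, norm_inv, Real.norm_of_nonneg hρ.le, inv_mul_le_iff₀ hρ, ← dist_eq_norm]
      exact (mem_ball.1 hh).le)
    rwa [smul_add, smul_smul, mul_inv_cancel₀ hρ.ne', one_smul, add_sub_cancel] at this
  have hinc : ∀ e ∈ E, ∫⁻ x, ∫⁻ h in ball (ρ • e) (ρ * δ),
      2 * (sqDiff D u x (x + h) + sqDiff D u (x + h) (x + k)) ≤
        4 * ∫⁻ h in closedBall (0 : Rd d) (3 * ρ), increment D u h := by
    intro e he
    have mi := measurable_increment hD hu
    have e1 : ∀ h : Rd d, ∫⁻ x, 2 * (sqDiff D u x (x + h) + sqDiff D u (x + h) (x + k)) =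
        2 * (increment D u h + increment D u (k - h)) := by
      intro h
      have n1 : Measurable fun x => sqDiff D u x (x + h) :=
        measurable_sqDiff_comp hD hu (by fun_prop) (by fun_prop)
      have n2 : Measurable fun x => sqDiff D u (x + h) (x + k) :=
        measurable_sqDiff_comp hD hu (by fun_prop) (by fun_prop)
      have n3 : Measurable fun x => sqDiff D u x (x + h) + sqDiff D u (x + h) (x + k) := n1.add n2
      rw [lintegral_const_mul _ n3, lintegral_add_left n1, lintegral_sqDiff_add_add,
        increment, increment]
    rw [lintegral_lintegral_swap m1.aemeasurable]
    simp only [e1]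
    have m2 : Measurable fun h => increment D u (k - h) := mi.comp (by fun_prop)
    have m3 : Measurable fun h => increment D u h + increment D u (k - h) := mi.add m2
    rw [lintegral_const_mul _ m3, lintegral_add_left mi]
    have b1 : ∫⁻ h in ball (ρ • e) (ρ * δ), increment D u h ≤
        ∫⁻ h in closedBall (0 : Rd d) (3 * ρ), increment D u h := by
      refine lintegral_mono_set fun h hh => ?_
      have := hsub e he h hh
      rw [mem_closedBall_zero_iff]
      linarith
    have b2 : ∫⁻ h in ball (ρ • e) (ρ * δ), increment D u (k - h) ≤
        ∫⁻ h in closedBall (0 : Rd d) (3 * ρ), increment D u h := by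
      rw [← lintegral_indicator measurableSet_ball, ← lintegral_indicator measurableSet_closedBall,
        ← lintegral_sub_left_eq_self _ k]
      refine lintegral_mono fun h => ?_
      by_cases hh : k - h ∈ ball (ρ • e) (ρ * δ)
      · have h1 := hsub e he _ hh
        have h2 : h ∈ closedBall (0 : Rd d) (3 * ρ) := by
          rw [mem_closedBall_zero_iff]
          have := norm_sub_le k (k - h)
          rw [sub_sub_cancel] at this
          linarith
        rw [indicator_of_mem hh, indicator_of_mem h2, sub_sub_cancel]
      · rw [indicator_of_notMem hh]
        exact zero_le
    calc _ ≤ 2 * ((∫⁻ h in closedBall (0 : Rd d) (3 * ρ), increment D u h) +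
          ∫⁻ h in closedBall (0 : Rd d) (3 * ρ), increment D u h) := by gcongr
      _ = _ := by ring
  calc volume (ball (0 : Rd d) (ρ * δ)) * increment D u k
      = ∫⁻ x, volume (ball (0 : Rd d) (ρ * δ)) * sqDiff D u x (x + k) := by
        rw [increment, lintegral_const_mul]
        exact measurable_sqDiff_comp hD hu (by fun_prop) (by fun_prop)
    _ ≤ ∫⁻ x, ∑ e ∈ E, ∫⁻ h in ball (ρ • e) (ρ * δ),
        2 * (sqDiff D u x (x + h) + sqDiff D u (x + h) (x + k)) := lintegral_mono key
    _ = ∑ e ∈ E, ∫⁻ x, ∫⁻ h in ball (ρ • e) (ρ * δ),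
        2 * (sqDiff D u x (x + h) + sqDiff D u (x + h) (x + k)) :=
        lintegral_finsetSum _ fun e _ => m1.lintegral_prod_right'
    _ ≤ ∑ e ∈ E, 4 * ∫⁻ h in closedBall (0 : Rd d) (3 * ρ), increment D u h :=
        Finset.sum_le_sum hinc
    _ = _ := by
        rw [Finset.sum_const, nsmul_eq_mul]
        push_cast
        ring

end Cone

/-! ### The uniform cone condition for Lipschitz domains and balls -/

section UniformConeExamples

variable {D : Set (Rd d)}

/-- By compactness, interior cones near each point of the closure of a bounded set give the
uniform cone condition. -/
lemma exists_uniformCone (hb : Bornology.IsBounded D)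
    (hloc : ∀ p ∈ closure D, ∃ (e : Rd d) (r δ : ℝ), ‖e‖ ≤ 1 ∧ 0 < r ∧ 0 < δ ∧
      ∀ y ∈ D, dist y p < r → ∀ ρ : ℝ, 0 ≤ ρ → ρ ≤ r → ∀ w : Rd d, ‖w‖ ≤ δ →
        y + ρ • (e + w) ∈ D) :
    ∃ (E : Finset (Rd d)) (R δ : ℝ), 0 < R ∧ R ≤ 1 ∧ 0 < δ ∧ δ ≤ 1 ∧ UniformCone D E R δ := by
  classical
  let P : Set (Rd d) → Prop := fun S => ∃ (E : Finset (Rd d)) (R δ : ℝ),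
    0 < R ∧ R ≤ 1 ∧ 0 < δ ∧ δ ≤ 1 ∧ (∀ e ∈ E, ‖e‖ ≤ 1) ∧
      ∀ x ∈ S, ∃ e ∈ E, ∀ y ∈ D, dist y x ≤ R → ∀ ρ : ℝ, 0 ≤ ρ → ρ ≤ R →
        ∀ w : Rd d, ‖w‖ ≤ δ → y + ρ • (e + w) ∈ D
  have hP : P (closure D) := by
    refine hb.isCompact_closure.induction_on (p := P) ?_ ?_ ?_ ?_
    · exact ⟨∅, 1, 1, one_pos, le_rfl, one_pos, le_rfl, by simp, by simp⟩
    · rintro S T hST ⟨E, R, δ, h1, h2, h3, h4, h5, h6⟩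
      exact ⟨E, R, δ, h1, h2, h3, h4, h5, fun x hx => h6 x (hST hx)⟩
    · rintro S T ⟨E, R, δ, h1, h2, h3, h4, h5, h6⟩ ⟨E', R', δ', h1', h2', h3', h4', h5', h6'⟩
      refine ⟨E ∪ E', min R R', min δ δ', lt_min h1 h1', min_le_of_left_le h2, lt_min h3 h3',
        min_le_of_left_le h4, ?_, ?_⟩
      · intro e he
        rcases Finset.mem_union.1 he with he | he
        exacts [h5 e he, h5' e he]
      · rintro x (hx | hx)
        · obtain ⟨e, he, H⟩ := h6 x hx
          exact ⟨e, Finset.mem_union_left _ he, fun y hy hyx ρ h0 hρ w hw =>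
            H y hy (hyx.trans (min_le_left _ _)) ρ h0 (hρ.trans (min_le_left _ _)) w
              (hw.trans (min_le_left _ _))⟩
        · obtain ⟨e, he, H⟩ := h6' x hx
          exact ⟨e, Finset.mem_union_right _ he, fun y hy hyx ρ h0 hρ w hw =>
            H y hy (hyx.trans (min_le_right _ _)) ρ h0 (hρ.trans (min_le_right _ _)) w
              (hw.trans (min_le_right _ _))⟩
    · intro p hp
      obtain ⟨e, r, δ, he, hr, hδ, H⟩ := hloc p hp
      refine ⟨ball p (r / 2), mem_nhdsWithin_of_mem_nhds (ball_mem_nhds p (half_pos hr)),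
        {e}, min 1 (r / 3), min 1 δ, lt_min one_pos (by positivity), min_le_left _ _,
        lt_min one_pos hδ, min_le_left _ _, by simpa using he, fun x hx => ⟨e, by simp, ?_⟩⟩
      intro y hy hyx ρ h0 hρ w hw
      have h1 := min_le_right 1 (r / 3)
      refine H y hy ?_ ρ h0 (by linarith) w (hw.trans (min_le_right _ _))
      have := dist_triangle y x p
      have := mem_ball.1 hx
      linarith
  obtain ⟨E, R, δ, h1, h2, h3, h4, h5, h6⟩ := hP
  exact ⟨E, R, δ, h1, h2, h3, h4, h5, fun x hx => h6 x (subset_closure hx)⟩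

/-- The cone at a point above the graph of a `K`-Lipschitz function has the graph direction as axis
and an aperture `(2 K + 1)⁻¹`. -/
lemma IsLipschitzDomain.exists_uniformCone (hD : IsLipschitzDomain D)
    (hb : Bornology.IsBounded D) :
    ∃ (E : Finset (Rd d)) (R δ : ℝ), 0 < R ∧ R ≤ 1 ∧ 0 < δ ∧ δ ≤ 1 ∧ UniformCone D E R δ := by
  refine NonlocalForms.exists_uniformCone hb fun p hp => ?_
  by_cases hpD : p ∈ D
  · obtain ⟨s, hs, hsub⟩ := Metric.isOpen_iff.1 hD.isOpen p hpD
    refine ⟨0, s / 2, 1, by simp, half_pos hs, one_pos, ?_⟩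
    intro y hy hyp ρ h0 hρ w hw
    refine hsub ?_
    rw [zero_add, mem_ball]
    have h1 : dist (y + ρ • w) y ≤ s / 2 := by
      rw [dist_eq_norm, add_sub_cancel_left, norm_smul, Real.norm_of_nonneg h0]
      nlinarith [norm_nonneg w]
    have := dist_triangle (y + ρ • w) y p
    linarith
  · have hfr : p ∈ frontier D := by
      rw [hD.isOpen.frontier_eq]
      exact ⟨hp, hpD⟩
    obtain ⟨e, g, K, r, he, hg, hr, hgraph⟩ := hD.boundary_graph p hfr
    have hK : (0 : ℝ) ≤ K := K.2
    have hδ1 : (2 * (K : ℝ) + 1)⁻¹ ≤ 1 := inv_le_one_of_one_le₀ (by linarith)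
    refine ⟨e, r / 4, (2 * K + 1)⁻¹, he.le, by positivity, by positivity, ?_⟩
    intro y hy hyp ρ h0 hρ w hw
    have hw1 : ‖w‖ ≤ 1 := hw.trans hδ1
    rcases h0.eq_or_lt with rfl | h0
    · simpa using hy
    have hyr : y ∈ ball p r := by rw [mem_ball]; linarith
    have hin : (inner ℝ e (y + ρ • (e + w)) : ℝ) = inner ℝ e y + ρ * (1 + inner ℝ e w) := by
      rw [inner_add_right, inner_smul_right, inner_add_right, real_inner_self_eq_norm_sq, he,
        one_pow]
    have hzr : y + ρ • (e + w) ∈ ball p r := by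
      have h1 : dist (y + ρ • (e + w)) y ≤ r / 4 * 2 := by
        rw [dist_eq_norm, add_sub_cancel_left, norm_smul, Real.norm_of_nonneg h0.le]
        have := norm_add_le e w
        exact mul_le_mul hρ (by linarith) (norm_nonneg _) (by positivity)
      have := dist_triangle (y + ρ • (e + w)) y p
      rw [mem_ball]
      linarith
    rw [hgraph _ hzr, hin]
    have hy' := (hgraph _ hyr).1 hy
    have hew : |(inner ℝ e w : ℝ)| ≤ ‖w‖ := by
      simpa [he] using abs_real_inner_le_norm e w
    have hlip := hg.dist_le_mul (y + ρ • (e + w) - (inner ℝ e y + ρ * (1 + inner ℝ e w)) • e)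
      (y - (inner ℝ e y : ℝ) • e)
    have hdiff : y + ρ • (e + w) - ((inner ℝ e y : ℝ) + ρ * (1 + inner ℝ e w)) • e -
        (y - (inner ℝ e y : ℝ) • e) = ρ • (w - (inner ℝ e w : ℝ) • e) := by
      module
    have hnorm : ‖w - (inner ℝ e w : ℝ) • e‖ ≤ 2 * ‖w‖ := by
      refine (norm_sub_le _ _).trans ?_
      rw [norm_smul, he, mul_one, Real.norm_eq_abs]
      linarith
    rw [dist_eq_norm (y + _ - _), hdiff, norm_smul, Real.norm_of_nonneg h0.le,
      Real.dist_eq] at hlip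
    have h1 := (abs_le.1 hlip).2
    have h2 : (K : ℝ) * (ρ * ‖w - (inner ℝ e w : ℝ) • e‖) ≤ K * (ρ * (2 * ‖w‖)) := by gcongr
    have h3 : ‖w‖ * (2 * K + 1) ≤ 1 := by
      have := mul_le_mul_of_nonneg_right hw (by positivity : (0 : ℝ) ≤ 2 * K + 1)
      rwa [inv_mul_cancel₀ (by positivity)] at this
    have h4 := (abs_le.1 hew).1
    have h5 : ρ * (‖w‖ * (2 * K + 1)) ≤ ρ * 1 := by gcongr
    have h6 : ρ * (-‖w‖) ≤ ρ * inner ℝ e w := by gcongr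
    linarith

/-- Near a point `p` of the closed unit ball, the cones with axis `-p` point inside the ball. -/
lemma exists_uniformCone_unitBall (d : ℕ) :
    ∃ (E : Finset (Rd d)) (R δ : ℝ), 0 < R ∧ R ≤ 1 ∧ 0 < δ ∧ δ ≤ 1 ∧
      UniformCone (ball (0 : Rd d) 1) E R δ := by
  refine exists_uniformCone isBounded_ball fun p hp => ?_
  have hp1 : ‖p‖ ≤ 1 := by simpa using closure_ball_subset_closedBall hp
  refine ⟨-p, 1 / 2, 1 / 4, by simpa using hp1, by norm_num, by norm_num, ?_⟩
  intro y hy hyp ρ h0 hρ w hw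
  rw [mem_ball_zero_iff] at hy ⊢
  rw [dist_eq_norm] at hyp
  have h1 : y + ρ • (-p + w) = (1 - ρ) • y + ρ • ((y - p) + w) := by module
  rw [h1]
  refine (norm_add_le _ _).trans_lt ?_
  rw [norm_smul, norm_smul, Real.norm_of_nonneg h0, Real.norm_of_nonneg (by linarith)]
  have h2 := norm_add_le (y - p) w
  nlinarith

lemma UniformCone.ball_of_unitBall {E : Finset (Rd d)} {R δ : ℝ}
    (h : UniformCone (Metric.ball (0 : Rd d) 1) E R δ) (x₀ : Rd d) {r : ℝ} (hr : 0 < r) :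
    UniformCone (Metric.ball x₀ r) E (r * R) δ := by
  have hmem : ∀ x, x ∈ Metric.ball x₀ r ↔ r⁻¹ • (x - x₀) ∈ Metric.ball (0 : Rd d) 1 := by
    intro x
    rw [mem_ball_zero_iff, norm_smul, norm_inv, Real.norm_of_nonneg hr.le, inv_mul_lt_iff₀ hr,
      mul_one, mem_ball_iff_norm]
  refine ⟨h.1, fun x hx => ?_⟩
  obtain ⟨e, he, H⟩ := h.2 _ ((hmem x).1 hx)
  refine ⟨e, he, fun y hy hyx ρ h0 hρ w hw => (hmem _).2 ?_⟩
  have := H _ ((hmem y).1 hy) (by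
    rw [dist_smul₀, dist_sub_right, norm_inv, Real.norm_of_nonneg hr.le, inv_mul_le_iff₀ hr]
    exact hyx) (r⁻¹ * ρ) (by positivity) (by rwa [inv_mul_le_iff₀ hr]) w hw
  convert! this using 1
  module

end UniformConeExamples

/-! ### A nonlocal Poincaré inequality -/

lemma lintegral_const_mul_add {X : Type*} [MeasurableSpace X] {μ : Measure X} (c : ℝ≥0∞)
    {f g : X → ℝ≥0∞} (hf : Measurable f) (hg : Measurable g) :
    ∫⁻ x, c * (f x + g x) ∂μ = c * ((∫⁻ x, f x ∂μ) + ∫⁻ x, g x ∂μ) := by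
  have h : Measurable fun x => f x + g x := hf.add hg
  rw [lintegral_const_mul _ h, lintegral_add_left hf]

lemma le_div_mul_of_mul_le {v x a b : ℝ≥0∞} (hv : v ≠ 0) (hv' : v ≠ ∞) (h : v * x ≤ a * b) :
    x ≤ a / v * b := by
  rwa [← ENNReal.mul_div_right_comm, ENNReal.le_div_iff_mul_le (Or.inl hv) (Or.inl hv'), mul_comm]

section Poincare

variable {D : Set (Rd d)} {u : Rd d → ℝ}

/-- The interaction energy of two sets `A` and `B` inside `D`. -/
noncomputable def crossEnergy (D : Set (Rd d)) (u : Rd d → ℝ) (A B : Set (Rd d)) : ℝ≥0∞ :=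
  ∫⁻ x in A, ∫⁻ y in B, sqDiff D u x y

lemma crossEnergy_comm (hD : MeasurableSet D) (hu : Measurable u) (A B : Set (Rd d)) :
    crossEnergy D u A B = crossEnergy D u B A := by
  unfold crossEnergy
  rw [lintegral_lintegral_swap (measurable_sqDiff hD hu).aemeasurable]
  simp only [sqDiff_comm]

/-- The triangle inequality for interaction energies, averaged over intermediate points in `B`. -/
lemma volume_mul_crossEnergy_le (hD : MeasurableSet D) (hu : Measurable u) {A B C : Set (Rd d)}
    (hB : MeasurableSet B) (hBD : B ⊆ D) :
    volume B * crossEnergy D u A C ≤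
      2 * (volume C * crossEnergy D u A B + volume A * crossEnergy D u C B) := by
  have m1 : Measurable fun x => ∫⁻ y in B, sqDiff D u x y :=
    Measurable.lintegral_prod_right' (measurable_sqDiff hD hu)
  have m2 : ∀ a, Measurable fun x => sqDiff D u a x := fun a =>
    measurable_sqDiff_comp hD hu (by fun_prop) (by fun_prop)
  have key : ∀ a c, volume B * sqDiff D u a c ≤
      2 * ((∫⁻ y in B, sqDiff D u a y) + ∫⁻ y in B, sqDiff D u c y) := by
    intro a c
    rw [← lintegral_const_mul_add _ (m2 a) (m2 c), mul_comm, ← setLIntegral_const]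
    refine setLIntegral_mono' hB fun b hb => ?_
    have := sqDiff_le_two_mul (u := u) (x := a) (z := c) (hBD hb)
    rwa [sqDiff_comm b c] at this
  calc volume B * crossEnergy D u A C
      = ∫⁻ a in A, ∫⁻ c in C, volume B * sqDiff D u a c := by
        unfold crossEnergy
        rw [← lintegral_const_mul _ (Measurable.lintegral_prod_right' (measurable_sqDiff hD hu))]
        refine lintegral_congr fun a => ?_
        rw [lintegral_const_mul _ (m2 a)]
    _ ≤ ∫⁻ a in A, ∫⁻ c in C,
          2 * ((∫⁻ y in B, sqDiff D u a y) + ∫⁻ y in B, sqDiff D u c y) :=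
        lintegral_mono fun a => lintegral_mono fun c => key a c
    _ = ∫⁻ a in A, 2 * (volume C * (∫⁻ y in B, sqDiff D u a y) + crossEnergy D u C B) := by
        refine lintegral_congr fun a => ?_
        rw [lintegral_const_mul_add _ measurable_const m1, setLIntegral_const,
          mul_comm (volume C), crossEnergy]
    _ = _ := by
        rw [lintegral_const_mul_add _ (m1.const_mul _) measurable_const,
          lintegral_const_mul _ m1, setLIntegral_const, mul_comm (volume A)]
        rfl

lemma crossEnergy_le_of_dist_lt {A B : Set (Rd d)} (hD : MeasurableSet D) (hu : Measurable u)
    (hA : MeasurableSet A) (hB : MeasurableSet B) {s : ℝ}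
    (hAB : ∀ a ∈ A, ∀ b ∈ B, dist a b < s) :
    crossEnergy D u A B ≤ ∫⁻ h in ball (0 : Rd d) s, increment D u h := by
  have e : ∫⁻ h in ball (0 : Rd d) s, increment D u h =
      ∫⁻ x, ∫⁻ h in ball (0 : Rd d) s, sqDiff D u x (x + h) := by
    unfold increment
    rw [lintegral_lintegral_swap]
    exact (measurable_sqDiff_comp hD hu (by fun_prop) (by fun_prop)).aemeasurable
  rw [e, crossEnergy, ← lintegral_indicator hA]
  refine lintegral_mono fun a => ?_
  by_cases ha : a ∈ A
  swap
  · simp [ha]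
  rw [indicator_of_mem ha, ← lintegral_indicator hB, ← lintegral_indicator measurableSet_ball,
    ← lintegral_add_left_eq_self _ a]
  refine lintegral_mono fun h => ?_
  by_cases hh : a + h ∈ B
  · have : h ∈ ball (0 : Rd d) s := by
      have := hAB a ha _ hh
      simpa [dist_eq_norm] using this
    rw [indicator_of_mem hh, indicator_of_mem this]
  · simp [hh]

/-- A nonlocal Poincaré inequality: on a bounded connected open set, the energy of all pairs of
points is controlled by the energy of pairs at distance less than `s`. Balls of radius `s / 4` are
joined by chains of overlapping balls, which exist by connectedness. -/
lemma exists_crossEnergy_self_le (ho : IsOpen D) (hc : IsConnected D)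
    (hb : Bornology.IsBounded D) {s : ℝ} (hs : 0 < s) :
    ∃ C : ℝ≥0∞, C ≠ ∞ ∧ ∀ u : Rd d → ℝ, Measurable u →
      crossEnergy D u D D ≤ C * ∫⁻ h in ball (0 : Rd d) s, increment D u h := by
  have hD := ho.measurableSet
  have hs4 : 0 < s / 4 := by positivity
  let B : Rd d → Set (Rd d) := fun x => ball x (s / 4) ∩ D
  have hBm : ∀ x, MeasurableSet (B x) := fun x => measurableSet_ball.inter hD
  have hBtop : ∀ x, volume (B x) ≠ ∞ := fun x =>
    ((measure_mono inter_subset_left).trans_lt measure_ball_lt_top).ne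
  have hBpos : ∀ x ∈ D, volume (B x) ≠ 0 := fun x hx =>
    ((isOpen_ball.inter ho).measure_pos _ ⟨x, mem_ball_self hs4, hx⟩).ne'
  let P : Rd d → Rd d → Prop := fun x y => ∃ C : ℝ≥0∞, C ≠ ∞ ∧ ∀ u : Rd d → ℝ, Measurable u →
    crossEnergy D u (B x) (B y) ≤ C * ∫⁻ h in ball (0 : Rd d) s, increment D u h
  have hP : ∀ x ∈ D, ∀ y ∈ D, P x y := by
    intro x hx y hy
    refine hc.isPreconnected.induction₂ P ?_ ?_ ?_ hx hy
    · intro x _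
      filter_upwards [mem_nhdsWithin_of_mem_nhds (ball_mem_nhds x hs4)] with y hy
      refine ⟨1, ENNReal.one_ne_top, fun u hu => ?_⟩
      rw [one_mul]
      refine crossEnergy_le_of_dist_lt hD hu (hBm _) (hBm _) fun a ha b hb => ?_
      have h1 := mem_ball.1 ha.1
      have h2 := mem_ball'.1 hb.1
      have h3 := mem_ball'.1 hy
      have := dist_triangle4 a x y b
      linarith
    · rintro x y z hx hy hz ⟨C, hC, h1⟩ ⟨C', hC', h2⟩
      refine ⟨2 * (volume (B z) * C + volume (B x) * C') / volume (B y), ?_, fun u hu => ?_⟩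
      · refine ENNReal.div_ne_top (ENNReal.mul_ne_top (by simp) (ENNReal.add_ne_top.2
          ⟨ENNReal.mul_ne_top (hBtop _) hC, ENNReal.mul_ne_top (hBtop _) hC'⟩)) (hBpos y hy)
      · have h3 := volume_mul_crossEnergy_le (A := B x) (C := B z) hD hu (hBm y) inter_subset_right
        rw [crossEnergy_comm hD hu (B z) (B y)] at h3
        refine le_div_mul_of_mul_le (hBpos y hy) (hBtop y) (h3.trans ?_)
        calc _ ≤ 2 * (volume (B z) * (C * ∫⁻ h in ball (0 : Rd d) s, increment D u h) +
              volume (B x) * (C' * ∫⁻ h in ball (0 : Rd d) s, increment D u h)) := by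
              gcongr
              exacts [h1 u hu, h2 u hu]
          _ = _ := by ring
    · rintro x y _ _ ⟨C, hC, h⟩
      exact ⟨C, hC, fun u hu => by rw [crossEnergy_comm hD hu]; exact h u hu⟩
  obtain ⟨t, htD, htf, ht⟩ := finite_approx_of_totallyBounded
    (hb.isCompact_closure.totallyBounded.subset subset_closure) (s / 4) hs4
  lift t to Finset (Rd d) using htf
  choose! C hC hCP using hP
  refine ⟨∑ x ∈ t, ∑ y ∈ t, C x y, ?_, fun u hu => ?_⟩
  · refine ENNReal.sum_ne_top.2 fun x hx => ENNReal.sum_ne_top.2 fun y hy => ?_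
    exact hC x (htD hx) y (htD hy)
  · have hcov : D ⊆ ⋃ x ∈ t, B x := by
      intro z hz
      obtain ⟨x, hx, hzx⟩ := mem_iUnion₂.1 (ht hz)
      exact mem_iUnion₂.2 ⟨x, hx, hzx, hz⟩
    have hint : ∀ f : Rd d → ℝ≥0∞, ∫⁻ x in D, f x ≤ ∑ x ∈ t, ∫⁻ y in B x, f y := by
      intro f
      refine (lintegral_mono_set hcov).trans ?_
      rw [← lintegral_finsetSum_measure]
      refine lintegral_mono' ?_ le_rfl
      rw [← Measure.sum_coe_finset]
      exact Measure.restrict_biUnion_le t.countable_toSet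
    have m1 : ∀ y, Measurable fun x => ∫⁻ z in B y, sqDiff D u x z := fun y =>
      Measurable.lintegral_prod_right' (measurable_sqDiff hD hu)
    calc crossEnergy D u D D ≤ ∑ x ∈ t, ∫⁻ a in B x, ∑ y ∈ t, ∫⁻ b in B y, sqDiff D u a b :=
          (hint _).trans (Finset.sum_le_sum fun x _ => lintegral_mono fun a => hint _)
      _ = ∑ x ∈ t, ∑ y ∈ t, crossEnergy D u (B x) (B y) := by
          refine Finset.sum_congr rfl fun x _ => ?_
          rw [lintegral_finsetSum _ fun y _ => m1 y]
          rfl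
      _ ≤ ∑ x ∈ t, ∑ y ∈ t, C x y * ∫⁻ h in ball (0 : Rd d) s, increment D u h :=
          Finset.sum_le_sum fun x hx => Finset.sum_le_sum fun y hy =>
            hCP x (htD hx) y (htD hy) u hu
      _ = _ := by simp only [Finset.sum_mul]

lemma volume_mul_increment_le (hD : MeasurableSet D) (hu : Measurable u) (h : Rd d) :
    volume D * increment D u h ≤ 4 * crossEnergy D u D D := by
  have m1 : Measurable fun x => ∫⁻ y in D, sqDiff D u x y :=
    Measurable.lintegral_prod_right' (measurable_sqDiff hD hu)
  have m2 : ∀ a, Measurable fun x => sqDiff D u a x := fun a =>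
    measurable_sqDiff_comp hD hu (by fun_prop) (by fun_prop)
  have hsupp : ∫⁻ x, ∫⁻ y in D, sqDiff D u x y = crossEnergy D u D D := by
    rw [crossEnergy, ← lintegral_indicator hD]
    refine lintegral_congr fun x => ?_
    by_cases hx : x ∈ D
    · rw [indicator_of_mem hx]
    · rw [indicator_of_notMem hx]
      simp [sqDiff_of_notMem (D := D) (u := u) (x := x) (fun h => hx h.1)]
  calc volume D * increment D u h = ∫⁻ x, volume D * sqDiff D u x (x + h) := by
        rw [increment, lintegral_const_mul]
        exact measurable_sqDiff_comp hD hu (by fun_prop) (by fun_prop)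
    _ ≤ ∫⁻ x, 2 * ((∫⁻ y in D, sqDiff D u x y) + ∫⁻ y in D, sqDiff D u (x + h) y) := by
        refine lintegral_mono fun x => ?_
        rw [← lintegral_const_mul_add _ (m2 x) (m2 (x + h)), mul_comm, ← setLIntegral_const]
        refine setLIntegral_mono' hD fun y hy => ?_
        have := sqDiff_le_two_mul (u := u) (x := x) (z := x + h) hy
        rwa [sqDiff_comm y] at this
    _ = 4 * crossEnergy D u D D := by
        have m3 : Measurable fun x => ∫⁻ y in D, sqDiff D u (x + h) y :=
          m1.comp (measurable_id.add_const h)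
        rw [lintegral_const_mul_add _ m1 m3,
          lintegral_add_right_eq_self (fun x => ∫⁻ y in D, sqDiff D u x y) h, hsupp]
        ring

/-- On a bounded connected open set, all shifts are controlled by the shifts of length at most
`s`. -/
lemma exists_increment_le_of_small (ho : IsOpen D) (hc : IsConnected D)
    (hb : Bornology.IsBounded D) {s : ℝ} (hs : 0 < s) :
    ∃ C : ℝ≥0, ∀ u : Rd d → ℝ, Measurable u → ∀ B : ℝ≥0∞,
      (∀ k : Rd d, ‖k‖ ≤ s → increment D u k ≤ B) → ∀ h : Rd d, increment D u h ≤ C * B := by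
  obtain ⟨C, hC, H⟩ := exists_crossEnergy_self_le ho hc hb hs
  have hpos : volume D ≠ 0 := (ho.measure_pos _ hc.nonempty).ne'
  have htop : volume D ≠ ∞ := hb.measure_lt_top.ne
  have hfin : 4 * (C * volume (ball (0 : Rd d) s)) / volume D ≠ ∞ :=
    ENNReal.div_ne_top (ENNReal.mul_ne_top (by simp)
      (ENNReal.mul_ne_top hC measure_ball_lt_top.ne)) hpos
  refine ⟨(4 * (C * volume (ball (0 : Rd d) s)) / volume D).toNNReal, fun u hu B hB h => ?_⟩
  rw [ENNReal.coe_toNNReal hfin]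
  refine le_div_mul_of_mul_le hpos htop ((volume_mul_increment_le ho.measurableSet hu h).trans ?_)
  have h1 : ∫⁻ h in ball (0 : Rd d) s, increment D u h ≤ B * volume (ball (0 : Rd d) s) := by
    rw [← setLIntegral_const]
    exact setLIntegral_mono' measurableSet_ball fun k hk => hB k (mem_ball_zero_iff.1 hk).le
  calc 4 * crossEnergy D u D D ≤ 4 * (C * (B * volume (ball (0 : Rd d) s))) := by
        gcongr
        exact (H u hu).trans (by gcongr)
    _ = _ := by ring

end Poincare

/-! ### The layer-cake formula -/

section LayerCake

/-- The layer-cake formula for functions with values in `[0, ∞]`. -/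
lemma lintegral_eq_lintegral_meas_ofReal_lt {X : Type*} [MeasurableSpace X] (m : Measure X)
    [SFinite m] {f : X → ℝ≥0∞} (hf : Measurable f) :
    ∫⁻ x, f x ∂m = ∫⁻ t in Ioi (0 : ℝ), m {x | ENNReal.ofReal t < f x} := by
  have hS : MeasurableSet {p : ℝ × X | ENNReal.ofReal p.1 < f p.2} :=
    measurableSet_lt (by fun_prop) (by fun_prop)
  have h1 : ∀ t : ℝ, m {x | ENNReal.ofReal t < f x} =
      ∫⁻ x, {p : ℝ × X | ENNReal.ofReal p.1 < f p.2}.indicator 1 (t, x) ∂m := by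
    intro t
    rw [← lintegral_indicator_one (measurableSet_lt measurable_const hf)]
    rfl
  have hvol : ∀ a : ℝ≥0∞, volume.restrict (Ioi (0 : ℝ)) {t | ENNReal.ofReal t < a} = a := by
    intro a
    rw [Measure.restrict_apply (measurableSet_lt (by fun_prop) measurable_const)]
    induction a with
    | top => simp
    | coe r =>
      have : {t : ℝ | ENNReal.ofReal t < (r : ℝ≥0∞)} ∩ Ioi 0 = Ioo 0 (r : ℝ) := by
        ext t
        simp only [mem_inter_iff, mem_ofPred_eq, mem_Ioi, mem_Ioo]
        rw [and_comm]
        refine and_congr_right fun ht => ?_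
        rw [← ENNReal.ofReal_coe_nnreal, ENNReal.ofReal_lt_ofReal_iff_of_nonneg ht.le]
      rw [this]
      simp
  simp only [h1]
  have hS' : Measurable ({p : ℝ × X | ENNReal.ofReal p.1 < f p.2}.indicator
      (1 : ℝ × X → ℝ≥0∞)) := measurable_one.indicator hS
  rw [lintegral_lintegral_swap (f := fun t x =>
    {p : ℝ × X | ENNReal.ofReal p.1 < f p.2}.indicator (1 : ℝ × X → ℝ≥0∞) (t, x)) hS'.aemeasurable]
  refine lintegral_congr fun x => ?_
  refine (hvol (f x)).symm.trans ?_
  rw [← lintegral_indicator_one (measurableSet_lt (by fun_prop) measurable_const)]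
  rfl

lemma lintegral_le_mul_of_meas_lt_le {X Y : Type*} [MeasurableSpace X] [MeasurableSpace Y]
    {m : Measure X} {κ : Measure Y} [SFinite m] [SFinite κ] {f : X → ℝ≥0∞} {g : Y → ℝ≥0∞}
    (hf : Measurable f) (hg : Measurable g) {C : ℝ≥0∞} (hC : C ≠ ∞)
    (h : ∀ t, m {x | t < f x} ≤ C * κ {y | t < g y}) :
    ∫⁻ x, f x ∂m ≤ C * ∫⁻ y, g y ∂κ := by
  rw [lintegral_eq_lintegral_meas_ofReal_lt m hf, lintegral_eq_lintegral_meas_ofReal_lt κ hg,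
    ← lintegral_const_mul' _ _ hC]
  exact lintegral_mono fun t => h _

end LayerCake

/-! ### Measures satisfying the upper bound -/

section UpperBound

variable {α C : ℝ} {ν : Measure (Rd d)}

/-- The upper-bound assumption makes `ν` finite away from the origin. -/
lemma UpperBound.sigmaFinite (hν : UpperBound α C ν) (h0 : ν {0} = 0) : SigmaFinite ν := by
  refine Measure.sigmaFinite_of_countable
    (S := insert {0} (range fun n : ℕ => {z : Rd d | 1 / ((n : ℝ) + 1) ≤ ‖z‖}))
    ((countable_range _).insert _) ?_ ?_
  · rintro s (rfl | ⟨n, rfl⟩)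
    · simp [h0]
    · have hr : (0 : ℝ) < 1 / ((n : ℝ) + 1) := Nat.one_div_pos_of_nat
      have hr1 : 1 / ((n : ℝ) + 1) ≤ 1 := by
        rw [div_le_one (by positivity)]
        linarith [(Nat.cast_nonneg n : (0 : ℝ) ≤ n)]
      set r := 1 / ((n : ℝ) + 1)
      have h1 := (mul_meas_ge_le_lintegral (μ := ν)
        (f := fun z : Rd d => ENNReal.ofReal ((min r ‖z‖) ^ 2)) (by fun_prop)
        (ENNReal.ofReal (r ^ 2))).trans (hν r hr hr1)
      have h2 : {z : Rd d | r ≤ ‖z‖} ⊆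
          {z | ENNReal.ofReal (r ^ 2) ≤ ENNReal.ofReal ((min r ‖z‖) ^ 2)} := by
        intro z hz
        have hz' : r ≤ ‖z‖ := hz
        simp [min_eq_left hz']
      refine (measure_mono h2).trans_lt ?_
      refine lt_of_le_of_ne le_top fun h => ?_
      rw [h, ENNReal.mul_top (by simp; positivity)] at h1
      exact absurd h1 (by simp)
  · rw [eq_univ_iff_forall]
    intro z
    by_cases hz : z = 0
    · exact ⟨{0}, mem_insert _ _, hz⟩
    · obtain ⟨n, hn⟩ := exists_nat_one_div_lt (norm_pos_iff.2 hz)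
      exact ⟨_, mem_insert_of_mem _ ⟨n, rfl⟩, hn.le⟩

lemma setLIntegral_Ioo_rpow (hα : α < 2) {a : ℝ} (ha : 0 < a) :
    ∫⁻ s in Ioo 0 a, ENNReal.ofReal ((2 - α) * s ^ (1 - α)) = ENNReal.ofReal (a ^ (2 - α)) := by
  have hint : IntervalIntegrable (fun s : ℝ => (2 - α) * s ^ (1 - α)) volume 0 a :=
    (intervalIntegral.intervalIntegrable_rpow' (by linarith)).const_mul _
  rw [restrict_Ioo_eq_restrict_Ioc, ← ofReal_integral_eq_lintegral_ofReal hint.1,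
    ← intervalIntegral.integral_of_le ha.le, intervalIntegral.integral_const_mul,
    integral_rpow (Or.inl (by linarith))]
  · rw [show 1 - α + 1 = 2 - α by ring, Real.zero_rpow (by linarith), sub_zero,
      mul_div_cancel₀ _ (by linarith)]
  · filter_upwards [ae_restrict_mem measurableSet_Ioc] with s hs
    have := Real.rpow_nonneg hs.1.le (1 - α)
    exact mul_nonneg (by linarith) this

/-- For antitone functions of the distance to the origin, a measure satisfying the upper bound is
dominated by the one-dimensional measure `(2 - α) s ^ (1 - α) ds`: the superlevel sets are
intervals starting at `0`, on which the upper bound compares the two measures. -/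
lemma UpperBound.lintegral_antitone_le (hν : UpperBound α C ν) (h0 : ν {0} = 0) (hα : α < 2)
    (hC : 0 ≤ C) {R : ℝ} (hR : 0 < R) (hR1 : R ≤ 1) {Ψ : ℝ → ℝ≥0∞} (hΨ : Antitone Ψ) :
    ∫⁻ z, ENNReal.ofReal ((min R ‖z‖) ^ 2) * Ψ (min R ‖z‖) ∂ν ≤
      ENNReal.ofReal C * ∫⁻ s in Ioo 0 R, ENNReal.ofReal ((2 - α) * s ^ (1 - α)) * Ψ s := by
  have := hν.sigmaFinite h0
  have hw : Measurable fun z : Rd d => ENNReal.ofReal ((min R ‖z‖) ^ 2) := by fun_prop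
  have hk : Measurable fun s : ℝ => ENNReal.ofReal ((2 - α) * s ^ (1 - α)) := by fun_prop
  have hf : Measurable fun z : Rd d => Ψ (min R ‖z‖) := hΨ.measurable.comp (by fun_prop)
  refine (lintegral_withDensity_eq_lintegral_mul₀ hw.aemeasurable hf.aemeasurable).symm.trans_le
    (le_of_le_of_eq ?_ (congrArg (ENNReal.ofReal C * ·)
      (lintegral_withDensity_eq_lintegral_mul₀ hk.aemeasurable hΨ.measurable.aemeasurable)))
  refine lintegral_le_mul_of_meas_lt_le hf hΨ.measurable ENNReal.ofReal_ne_top fun t => ?_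
  -- the part of the superlevel set in `(0, R]`, an interval from `0` to `sSup A`
  let A : Set ℝ := {s | (0 < s ∧ s ≤ R) ∧ t < Ψ s}
  have hmem : ∀ z : Rd d, t < Ψ (min R ‖z‖) → z ≠ 0 → min R ‖z‖ ∈ A := fun z hz hz0 =>
    ⟨⟨lt_min hR (norm_pos_iff.2 hz0), min_le_left _ _⟩, hz⟩
  rcases A.eq_empty_or_nonempty with hA | hA
  · have hsub : {z : Rd d | t < Ψ (min R ‖z‖)} ⊆ {0} := by
      intro z hz
      by_contra hz0
      have := hmem z hz hz0
      rw [hA] at this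
      exact this
    rw [measure_mono_null hsub (withDensity_absolutelyContinuous _ _ h0)]
    exact zero_le
  · have hbdd : BddAbove A := ⟨R, fun s hs => hs.1.2⟩
    set a := sSup A
    have ha0 : 0 < a := by
      obtain ⟨s, hs⟩ := hA
      exact hs.1.1.trans_le (le_csSup hbdd hs)
    have haR : a ≤ R := csSup_le hA fun s hs => hs.1.2
    have hsub : {z : Rd d | t < Ψ (min R ‖z‖)} ⊆ {z | min R ‖z‖ ≤ a} := by
      intro z hz
      by_cases hz0 : z = 0
      · simp [hz0, ha0.le]
      · exact le_csSup hbdd (hmem z hz hz0)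
    have hsub' : Ioo 0 a ⊆ {s | t < Ψ s} := by
      intro s hs
      obtain ⟨b, hb, hsb⟩ := exists_lt_of_lt_csSup hA hs.2
      exact hb.2.trans_le (hΨ hsb.le)
    have hT : MeasurableSet {z : Rd d | min R ‖z‖ ≤ a} :=
      measurableSet_le (by fun_prop) measurable_const
    calc ν.withDensity (fun z => ENNReal.ofReal ((min R ‖z‖) ^ 2)) {z | t < Ψ (min R ‖z‖)}
        ≤ ν.withDensity (fun z => ENNReal.ofReal ((min R ‖z‖) ^ 2)) {z | min R ‖z‖ ≤ a} :=
          measure_mono hsub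
      _ = ∫⁻ z in {z | min R ‖z‖ ≤ a}, ENNReal.ofReal ((min R ‖z‖) ^ 2) ∂ν :=
          withDensity_apply _ hT
      _ ≤ ∫⁻ z in {z | min R ‖z‖ ≤ a}, ENNReal.ofReal ((min a ‖z‖) ^ 2) ∂ν := by
          refine setLIntegral_mono' hT fun z hz => ENNReal.ofReal_le_ofReal ?_
          have h1 : min R ‖z‖ ≤ min a ‖z‖ := le_min hz (min_le_right _ _)
          have h2 : 0 ≤ min R ‖z‖ := le_min hR.le (norm_nonneg _)
          gcongr
      _ ≤ ∫⁻ z, ENNReal.ofReal ((min a ‖z‖) ^ 2) ∂ν := setLIntegral_le_lintegral _ _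
      _ ≤ ENNReal.ofReal (C * a ^ (2 - α)) := hν a ha0 (haR.trans hR1)
      _ = ENNReal.ofReal C * ∫⁻ s in Ioo 0 a, ENNReal.ofReal ((2 - α) * s ^ (1 - α)) := by
          rw [setLIntegral_Ioo_rpow hα ha0, ENNReal.ofReal_mul hC]
      _ = ENNReal.ofReal C * (volume.restrict (Ioo 0 R)).withDensity
            (fun s => ENNReal.ofReal ((2 - α) * s ^ (1 - α))) (Ioo 0 a) := by
          rw [withDensity_apply _ measurableSet_Ioo, Measure.restrict_restrict measurableSet_Ioo,
            inter_eq_left.2 (Ioo_subset_Ioo_right haR)]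
      _ ≤ _ := by gcongr

/-- The constant does not depend on `α`: the denominator `d + α` of the exact value is bounded below
by `α₀`, which also covers `d = 0`. -/
lemma setLIntegral_Ici_rpow_le {α₀ : ℝ} (hα₀ : 0 < α₀) (hα : α₀ ≤ α) (hα2 : α < 2) {b : ℝ}
    (hb : 0 < b) :
    ∫⁻ s in Ici (b / 3), ENNReal.ofReal ((2 - α) * s ^ (-(d : ℝ) - 1 - α)) ≤
      ENNReal.ofReal (3 ^ (d + 2) / α₀) * ENNReal.ofReal ((2 - α) * b ^ (-(d : ℝ) - α)) := by
  have hd : (0 : ℝ) ≤ d := Nat.cast_nonneg d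
  have hb3 : 0 < b / 3 := by positivity
  have hint := (integrableOn_Ioi_rpow_of_lt (a := -(d : ℝ) - 1 - α) (by linarith) hb3).const_mul
    (2 - α)
  rw [← restrict_Ioi_eq_restrict_Ici, ← ofReal_integral_eq_lintegral_ofReal hint,
    integral_const_mul, integral_Ioi_rpow_of_lt (by linarith) hb3,
    ← ENNReal.ofReal_mul (by positivity)]
  · refine ENNReal.ofReal_le_ofReal ?_
    rw [show -(d : ℝ) - 1 - α + 1 = -(d + α) by ring, neg_div_neg_eq,
      show -(d : ℝ) - α = -(d + α) by ring, Real.div_rpow hb.le (by norm_num),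
      Real.rpow_neg (by norm_num : (0 : ℝ) ≤ 3), div_inv_eq_mul]
    have h3 : (3 : ℝ) ^ ((d : ℝ) + α) ≤ 3 ^ (d + 2) := by
      rw [← Real.rpow_natCast]
      refine Real.rpow_le_rpow_of_exponent_le (by norm_num) ?_
      push_cast
      linarith
    have h4 : b ^ (-((d : ℝ) + α)) * 3 ^ ((d : ℝ) + α) / (d + α) ≤
        b ^ (-((d : ℝ) + α)) * 3 ^ (d + 2) / α₀ := by
      gcongr
      linarith
    calc (2 - α) * (b ^ (-((d : ℝ) + α)) * 3 ^ ((d : ℝ) + α) / (d + α))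
        ≤ (2 - α) * (b ^ (-((d : ℝ) + α)) * 3 ^ (d + 2) / α₀) :=
          mul_le_mul_of_nonneg_left h4 (by linarith)
      _ = _ := by ring
  · filter_upwards [ae_restrict_mem measurableSet_Ioi] with s hs
    have := Real.rpow_nonneg (hb3.trans hs).le (-(d : ℝ) - 1 - α)
    exact mul_nonneg (by linarith) this

/-- The comparison of `∫ F dν` with the integral of `F` against the kernel `(2 - α) |h|^(-d-α)`,
for a function `F` which is controlled by a radial modulus `Φ` such that `Φ(ρ) / ρ²` is essentially
decreasing and `Φ(ρ)` is controlled by an average of `F`. The constant depends neither on the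
scale `R` nor on `α ∈ [α₀, 2)`. -/
lemma UpperBound.lintegral_le {α₀ : ℝ} (hα₀ : 0 < α₀) (hα : α₀ ≤ α) (hα2 : α < 2)
    (hν : UpperBound α C ν) (h0 : ν {0} = 0) (hC : 0 ≤ C) {R : ℝ} (hR : 0 < R) (hR1 : R ≤ 1)
    {F : Rd d → ℝ≥0∞} (hF : Measurable F) (hF0 : F 0 = 0) {Φ : ℝ → ℝ≥0∞}
    {c₁ : ℝ≥0} {c₂ c₃ : ℝ} (hc₂ : 0 ≤ c₂) (hc₃ : 0 ≤ c₃)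
    (h₁ : ∀ h, F h ≤ c₁ * Φ (min R ‖h‖))
    (h₂ : ∀ s ρ : ℝ, 0 < s → s ≤ ρ → ρ ≤ R → Φ ρ ≤ ENNReal.ofReal (c₂ * (ρ / s) ^ 2) * Φ s)
    (h₃ : ∀ ρ : ℝ, 0 < ρ → ρ ≤ R → Φ ρ ≤
      ENNReal.ofReal (c₃ * ρ ^ (-(d : ℝ))) * ∫⁻ h in closedBall (0 : Rd d) (3 * ρ), F h) :
    ∫⁻ z, F z ∂ν ≤
      (c₁ * ENNReal.ofReal C * ENNReal.ofReal (c₂ * c₃) * ENNReal.ofReal (3 ^ (d + 2) / α₀)) *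
        ∫⁻ h, F h * ENNReal.ofReal ((2 - α) * ‖h‖ ^ (-(d : ℝ) - α)) := by
  -- the decreasing envelope of `Φ(t) / t²` on `(0, R]`
  let Ψ : ℝ → ℝ≥0∞ := fun s => ⨆ t ∈ Icc s R, ENNReal.ofReal (t ^ 2)⁻¹ * Φ t
  have hΨ : Antitone Ψ := fun s s' hs => biSup_mono fun t ht => ⟨hs.trans ht.1, ht.2⟩
  have hΨle : ∀ s, 0 < s → Ψ s ≤ ENNReal.ofReal (c₂ * (s ^ 2)⁻¹) * Φ s := by
    intro s hs
    refine iSup₂_le fun t ht => ?_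
    have ht0 : 0 < t := hs.trans_le ht.1
    refine (mul_le_mul_right (h₂ s t hs ht.1 ht.2) _).trans_eq ?_
    rw [← mul_assoc, ← ENNReal.ofReal_mul (by positivity)]
    congr 2
    field_simp
  have hFΨ : ∀ z, F z ≤ c₁ * (ENNReal.ofReal ((min R ‖z‖) ^ 2) * Ψ (min R ‖z‖)) := by
    intro z
    by_cases hz : z = 0
    · rw [hz, hF0]
      exact zero_le
    · have hm : 0 < min R ‖z‖ := lt_min hR (norm_pos_iff.2 hz)
      refine (h₁ z).trans (mul_le_mul_right ?_ _)
      have : ENNReal.ofReal ((min R ‖z‖) ^ 2)⁻¹ * Φ (min R ‖z‖) ≤ Ψ (min R ‖z‖) :=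
        le_iSup₂_of_le (min R ‖z‖) ⟨le_rfl, min_le_left _ _⟩ le_rfl
      refine le_trans ?_ (mul_le_mul_right this _)
      rw [← mul_assoc, ← ENNReal.ofReal_mul (by positivity), mul_inv_cancel₀ (by positivity),
        ENNReal.ofReal_one, one_mul]
  let K : ℝ → Rd d → ℝ≥0∞ := fun s h => ENNReal.ofReal ((2 - α) * s ^ (-(d : ℝ) - 1 - α)) *
    (closedBall (0 : Rd d) (3 * s)).indicator F h
  have hKeq : ∀ p : ℝ × Rd d, K p.1 p.2 =
      ENNReal.ofReal ((2 - α) * p.1 ^ (-(d : ℝ) - 1 - α)) *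
        {q : ℝ × Rd d | ‖q.2‖ ≤ 3 * q.1}.indicator (fun q => F q.2) p := by
    intro p
    simp only [K, indicator, mem_closedBall_zero_iff, mem_ofPred_eq]
  have hK : Measurable fun p : ℝ × Rd d => K p.1 p.2 := by
    simp only [hKeq]
    have : MeasurableSet {q : ℝ × Rd d | ‖q.2‖ ≤ 3 * q.1} :=
      measurableSet_le (by fun_prop) (by fun_prop)
    exact Measurable.mul (by fun_prop) ((hF.comp measurable_snd).indicator this)
  have hstep : ∀ s ∈ Ioo 0 R, ENNReal.ofReal ((2 - α) * s ^ (1 - α)) * Ψ s ≤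
      ENNReal.ofReal (c₂ * c₃) * ∫⁻ h, K s h := by
    intro s hs
    have hs0 : 0 < s := hs.1
    have h2α : 0 ≤ 2 - α := by linarith
    have e : ∫⁻ h, K s h = ENNReal.ofReal ((2 - α) * s ^ (-(d : ℝ) - 1 - α)) *
        ∫⁻ h in closedBall (0 : Rd d) (3 * s), F h := by
      rw [lintegral_const_mul _ (hF.indicator measurableSet_closedBall),
        lintegral_indicator measurableSet_closedBall]
    have hpow : s ^ (1 - α) * (s ^ 2)⁻¹ * s ^ (-(d : ℝ)) = s ^ (-(d : ℝ) - 1 - α) := by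
      rw [← Real.rpow_natCast, ← Real.rpow_neg hs0.le, ← Real.rpow_add hs0, ← Real.rpow_add hs0]
      congr 1
      push_cast
      ring
    calc ENNReal.ofReal ((2 - α) * s ^ (1 - α)) * Ψ s
        ≤ ENNReal.ofReal ((2 - α) * s ^ (1 - α)) * (ENNReal.ofReal (c₂ * (s ^ 2)⁻¹) *
          (ENNReal.ofReal (c₃ * s ^ (-(d : ℝ))) *
            ∫⁻ h in closedBall (0 : Rd d) (3 * s), F h)) := by
          gcongr
          exact (hΨle s hs0).trans (mul_le_mul_right (h₃ s hs0 hs.2.le) _)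
      _ = ENNReal.ofReal (c₂ * c₃) * ∫⁻ h, K s h := by
          rw [e, ← mul_assoc, ← mul_assoc, ← mul_assoc, ← ENNReal.ofReal_mul (by positivity),
            ← ENNReal.ofReal_mul (by positivity), ← ENNReal.ofReal_mul (by positivity), ← hpow]
          congr 2
          ring
  have hKint : ∀ h, ∫⁻ s in Ioo 0 R, K s h ≤ ENNReal.ofReal (3 ^ (d + 2) / α₀) *
      (F h * ENNReal.ofReal ((2 - α) * ‖h‖ ^ (-(d : ℝ) - α))) := by
    intro h
    by_cases hh : h = 0
    · have : ∀ s, K s h = 0 := fun s => by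
        simp only [K, indicator]
        split_ifs <;> simp [hh, hF0]
      simp [this]
    · have hk : Measurable fun s : ℝ => ENNReal.ofReal ((2 - α) * s ^ (-(d : ℝ) - 1 - α)) := by
        fun_prop
      calc ∫⁻ s in Ioo 0 R, K s h ≤ ∫⁻ s, K s h := setLIntegral_le_lintegral _ _
        _ ≤ ∫⁻ s, (Ici (‖h‖ / 3)).indicator
              (fun s => F h * ENNReal.ofReal ((2 - α) * s ^ (-(d : ℝ) - 1 - α))) s := by
            refine lintegral_mono fun s => ?_
            by_cases hs : h ∈ closedBall (0 : Rd d) (3 * s)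
            · have hs' : s ∈ Ici (‖h‖ / 3) := by
                rw [mem_closedBall_zero_iff] at hs
                rw [mem_Ici, div_le_iff₀ (by norm_num)]
                linarith
              simp only [K]
              rw [indicator_of_mem hs, indicator_of_mem hs', mul_comm]
            · simp only [K]
              rw [indicator_of_notMem hs, mul_zero]
              exact zero_le
        _ = F h * ∫⁻ s in Ici (‖h‖ / 3),
              ENNReal.ofReal ((2 - α) * s ^ (-(d : ℝ) - 1 - α)) := by
            rw [lintegral_indicator measurableSet_Ici, lintegral_const_mul _ hk]
        _ ≤ F h * (ENNReal.ofReal (3 ^ (d + 2) / α₀) *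
              ENNReal.ofReal ((2 - α) * ‖h‖ ^ (-(d : ℝ) - α))) := by
            gcongr
            exact setLIntegral_Ici_rpow_le hα₀ hα hα2 (norm_pos_iff.2 hh)
        _ = _ := by ring
  have hG : Measurable fun h => F h * ENNReal.ofReal ((2 - α) * ‖h‖ ^ (-(d : ℝ) - α)) := by
    fun_prop
  calc ∫⁻ z, F z ∂ν ≤ ∫⁻ z, c₁ * (ENNReal.ofReal ((min R ‖z‖) ^ 2) * Ψ (min R ‖z‖)) ∂ν :=
        lintegral_mono hFΨ
    _ = c₁ * ∫⁻ z, ENNReal.ofReal ((min R ‖z‖) ^ 2) * Ψ (min R ‖z‖) ∂ν :=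
        lintegral_const_mul' _ _ ENNReal.coe_ne_top
    _ ≤ c₁ * (ENNReal.ofReal C *
          ∫⁻ s in Ioo 0 R, ENNReal.ofReal ((2 - α) * s ^ (1 - α)) * Ψ s) := by
        gcongr
        exact hν.lintegral_antitone_le h0 hα2 hC hR hR1 hΨ
    _ ≤ c₁ * (ENNReal.ofReal C *
          ∫⁻ s in Ioo 0 R, ENNReal.ofReal (c₂ * c₃) * ∫⁻ h, K s h) := by
        refine mul_le_mul_right (mul_le_mul_right ?_ _) _
        exact setLIntegral_mono' measurableSet_Ioo hstep
    _ = c₁ * (ENNReal.ofReal C * (ENNReal.ofReal (c₂ * c₃) * ∫⁻ h, ∫⁻ s in Ioo 0 R, K s h)) := by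
        rw [lintegral_const_mul' _ _ ENNReal.ofReal_ne_top, lintegral_lintegral_swap hK.aemeasurable]
    _ ≤ c₁ * (ENNReal.ofReal C * (ENNReal.ofReal (c₂ * c₃) *
          ∫⁻ h, ENNReal.ofReal (3 ^ (d + 2) / α₀) *
            (F h * ENNReal.ofReal ((2 - α) * ‖h‖ ^ (-(d : ℝ) - α))))) := by
        gcongr with h
        exact hKint h
    _ = _ := by
        rw [lintegral_const_mul _ hG]
        ring

end UpperBound

/-! ### The two quadratic forms in terms of shifts -/

section Forms

variable {D : Set (Rd d)} {u v : Rd d → ℝ}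

lemma kernelForm_muAlpha_eq (hD : MeasurableSet D) (hu : Measurable u) (α : ℝ) :
    kernelForm (muAlpha d α) D u =
      ∫⁻ h, increment D u h * ENNReal.ofReal ((2 - α) * ‖h‖ ^ (-(d : ℝ) - α)) := by
  have hw : ∀ x : Rd d, Measurable fun y : Rd d =>
      ENNReal.ofReal ((2 - α) * ‖x - y‖ ^ (-(d : ℝ) - α)) := fun x => by fun_prop
  have hw0 : Measurable fun h : Rd d => ENNReal.ofReal ((2 - α) * ‖h‖ ^ (-(d : ℝ) - α)) := by
    fun_prop
  have e1 : ∀ x, D.indicator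
      (fun x => ∫⁻ y in D, ENNReal.ofReal ((u y - u x) ^ 2) ∂(muAlpha d α x)) x =
      ∫⁻ h, sqDiff D u x (x + h) * ENNReal.ofReal ((2 - α) * ‖h‖ ^ (-(d : ℝ) - α)) := by
    intro x
    by_cases hx : x ∈ D
    swap
    · rw [indicator_of_notMem hx]
      simp [sqDiff_of_notMem (D := D) (u := u) (x := x) (fun h => hx h.1)]
    have hg : Measurable fun y => ENNReal.ofReal ((u y - u x) ^ 2) := by fun_prop
    rw [indicator_of_mem hx, muAlpha, restrict_withDensity hD,
      lintegral_withDensity_eq_lintegral_mul _ (hw x) hg, ← lintegral_indicator hD,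
      ← lintegral_add_left_eq_self _ x]
    refine lintegral_congr fun h => ?_
    by_cases hh : x + h ∈ D
    · rw [indicator_of_mem hh, sqDiff_comm, sqDiff_of_mem hh hx, Pi.mul_apply, mul_comm,
        sub_add_cancel_left, norm_neg]
    · rw [indicator_of_notMem hh, sqDiff_of_notMem (fun h' => hh h'.2), zero_mul]
  rw [kernelForm, ← lintegral_indicator hD]
  simp only [e1]
  rw [lintegral_lintegral_swap]
  · refine lintegral_congr fun h => ?_
    rw [lintegral_mul_const _ (measurable_sqDiff_comp hD hu (by fun_prop) (by fun_prop)),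
      increment]
  · exact ((measurable_sqDiff_comp hD hu (by fun_prop) (by fun_prop)).mul
      (hw0.comp measurable_snd)).aemeasurable

lemma jumpForm_eq_lintegral_increment (hD : MeasurableSet D) (hu : Measurable u)
    (ν : Measure (Rd d)) [SFinite ν] : jumpForm ν D u = ∫⁻ z, increment D u z ∂ν := by
  have e1 : ∀ x, D.indicator
      (fun x => ∫⁻ z, D.indicator (fun y => ENNReal.ofReal ((u x - u y) ^ 2)) (x + z) ∂ν) x =
      ∫⁻ z, sqDiff D u x (x + z) ∂ν := by
    intro x
    by_cases hx : x ∈ D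
    swap
    · rw [indicator_of_notMem hx]
      simp [sqDiff_of_notMem (D := D) (u := u) (x := x) (fun h => hx h.1)]
    rw [indicator_of_mem hx]
    refine lintegral_congr fun z => ?_
    by_cases hz : x + z ∈ D
    · rw [indicator_of_mem hz, sqDiff_of_mem hx hz]
    · rw [indicator_of_notMem hz, sqDiff_of_notMem (fun h' => hz h'.2)]
  rw [jumpForm, ← lintegral_indicator hD]
  simp only [e1]
  rw [lintegral_lintegral_swap]
  · rfl
  · exact (measurable_sqDiff_comp hD hu (by fun_prop) (by fun_prop)).aemeasurable

lemma kernelForm_muAlpha_congr (α : ℝ) (h : u =ᵐ[volume.restrict D] v) :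
    kernelForm (muAlpha d α) D u = kernelForm (muAlpha d α) D v := by
  refine lintegral_congr_ae ?_
  filter_upwards [h] with x hx
  refine lintegral_congr_ae ?_
  have hac : (muAlpha d α x).restrict D ≪ volume.restrict D :=
    (withDensity_absolutelyContinuous _ _).restrict _
  filter_upwards [hac.ae_le h] with y hy
  rw [hx, hy]

/-- The form `jumpForm` does not depend on the representative of `u`, although `ν` may be singular:
for almost every `x` the point `x + z` avoids a given null set for `ν`-almost every `z`. -/
lemma jumpForm_congr (hD : MeasurableSet D) (ν : Measure (Rd d)) [SFinite ν]
    (h : u =ᵐ[volume.restrict D] v) : jumpForm ν D u = jumpForm ν D v := by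
  rw [Filter.EventuallyEq, ae_restrict_iff' hD] at h
  obtain ⟨N, hN, hNm, hN0⟩ := exists_measurable_superset_of_null (ae_iff.1 h)
  have huv : ∀ x ∉ N, x ∈ D → u x = v x := by
    intro x hx hxD
    by_contra hne
    exact hx (hN fun h' => hne (h' hxD))
  have h1 : ∀ᵐ x : Rd d, ∀ᵐ z ∂ν, x + z ∉ N := by
    rw [Measure.ae_ae_comm]
    · refine Filter.Eventually.of_forall fun z => ?_
      rw [ae_iff]
      simp only [not_not]
      exact (measure_preimage_add_right volume z N).trans hN0
    · exact (measurable_fst.add measurable_snd) hNm.compl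
  refine lintegral_congr_ae ?_
  filter_upwards [ae_restrict_mem hD, ae_restrict_of_ae (s := D) h1,
    ae_restrict_of_ae (s := D) (compl_mem_ae_iff.2 hN0)] with x hxD hx hxN
  refine lintegral_congr_ae ?_
  filter_upwards [hx] with z hz
  by_cases hzD : x + z ∈ D
  · rw [indicator_of_mem hzD, indicator_of_mem hzD, huv x hxN hxD, huv _ hz hzD]
  · rw [indicator_of_notMem hzD, indicator_of_notMem hzD]

end Forms

/-! ### Comparison of the two forms -/

section Comparison

variable {D : Set (Rd d)} {u : Rd d → ℝ} {E : Finset (Rd d)} {R δ : ℝ}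

/-- The largest squared `L²` modulus of a shift of length at most `ρ`. -/
noncomputable def shiftModulus (D : Set (Rd d)) (u : Rd d → ℝ) (ρ : ℝ) : ℝ≥0∞ :=
  ⨆ k ∈ closedBall (0 : Rd d) ρ, increment D u k

lemma increment_le_shiftModulus {k : Rd d} {ρ : ℝ} (hk : ‖k‖ ≤ ρ) :
    increment D u k ≤ shiftModulus D u ρ :=
  le_iSup₂_of_le k (mem_closedBall_zero_iff.2 hk) le_rfl

lemma increment_zero : increment D u 0 = 0 := by
  have : ∀ x, sqDiff D u x (x + 0) = 0 := by
    intro x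
    by_cases hx : x ∈ D
    · rw [add_zero, sqDiff_of_mem hx hx]
      simp
    · exact sqDiff_of_notMem fun h => hx h.1
  rw [increment, lintegral_congr this, lintegral_zero]

/-- Up to a constant, `ρ ↦ Φ(ρ) / ρ²` is decreasing, where `Φ` is the modulus of shifts. -/
lemma UniformCone.shiftModulus_le (hcone : UniformCone D E R δ) (hD : MeasurableSet D)
    (hu : Measurable u) (hδ : 0 < δ) (hδ1 : δ ≤ 1) {s ρ : ℝ} (hs : 0 < s) (hsρ : s ≤ ρ)
    (hρ : ρ ≤ δ * R) :
    shiftModulus D u ρ ≤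
      ENNReal.ofReal (36 * E.card / δ ^ 2 * (ρ / s) ^ 2) * shiftModulus D u s := by
  have hρ0 : 0 < ρ := hs.trans_le hsρ
  have hx : 1 ≤ ρ / (δ * s) := by
    rw [one_le_div (by positivity)]
    nlinarith
  -- the smallest number of steps for which the shorter shifts have length at most `s`
  set N := ⌈ρ / (δ * s)⌉₊
  have hN0 : 0 < N := Nat.ceil_pos.2 (by linarith)
  have hN1 : ρ / (δ * s) ≤ N := Nat.le_ceil _
  have hN2 : (N : ℝ) ≤ 2 * (ρ / (δ * s)) := by
    have := Nat.ceil_lt_add_one (zero_le_one.trans hx)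
    linarith
  have hN' : (0 : ℝ) < N := Nat.cast_pos.2 hN0
  refine iSup₂_le fun k hk => ?_
  rw [mem_closedBall_zero_iff] at hk
  refine (hcone.increment_le hD hu hδ hδ1 (hk.trans hρ) hN0
    (B := shiftModulus D u s) fun k' hk' => increment_le_shiftModulus (hk'.trans ?_)).trans ?_
  · rw [div_le_iff₀ (by positivity)] at hN1 ⊢
    nlinarith
  · gcongr
    rw [← ENNReal.ofReal_coe_nnreal]
    refine ENNReal.ofReal_le_ofReal ?_
    push_cast
    calc 9 * (E.card : ℝ) * (N : ℝ) ^ 2 ≤ 9 * E.card * (2 * (ρ / (δ * s))) ^ 2 := by gcongr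
      _ = _ := by
        field_simp
        ring

/-- The modulus of shifts is controlled by the average of all shifts of comparable size. -/
lemma UniformCone.shiftModulus_le_average (hcone : UniformCone D E R δ) (hD : MeasurableSet D)
    (hu : Measurable u) (hδ : 0 < δ) (hδ1 : δ ≤ 1) {ρ : ℝ} (hρ : 0 < ρ) (hρR : ρ ≤ R) :
    shiftModulus D u ρ ≤
      ENNReal.ofReal (4 * E.card / (volume.real (ball (0 : Rd d) 1) * δ ^ d) * ρ ^ (-(d : ℝ))) *
        ∫⁻ h in closedBall (0 : Rd d) (3 * ρ), increment D u h := by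
  refine iSup₂_le fun k hk => ?_
  rw [mem_closedBall_zero_iff] at hk
  have h := hcone.increment_le_average hD hu hδ1 hρ hρR hk
  have hvol : volume (ball (0 : Rd d) (ρ * δ)) =
      ENNReal.ofReal ((ρ * δ) ^ d * volume.real (ball (0 : Rd d) 1)) := by
    rw [Measure.addHaar_ball_of_pos volume _ (by positivity), finrank_euclideanSpace_fin,
      ENNReal.ofReal_mul (by positivity), Measure.real,
      ENNReal.ofReal_toReal measure_ball_lt_top.ne]
  have hV : 0 < volume.real (ball (0 : Rd d) 1) :=
    ENNReal.toReal_pos (measure_ball_pos _ _ one_pos).ne' measure_ball_lt_top.ne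
  have hpos : 0 < (ρ * δ) ^ d * volume.real (ball (0 : Rd d) 1) := by positivity
  rw [hvol] at h
  refine (le_div_mul_of_mul_le (ENNReal.ofReal_pos.2 hpos).ne' ENNReal.ofReal_ne_top h).trans_eq ?_
  rw [← ENNReal.ofReal_coe_nnreal, ← ENNReal.ofReal_div_of_pos hpos]
  congr 2
  rw [Real.rpow_neg hρ.le, Real.rpow_natCast, mul_pow]
  push_cast
  field_simp

/-- The comparison of the two forms on a set with the uniform cone condition on which large shifts
are controlled by small ones. The constant does not depend on the scale `R`. -/
lemma UniformCone.jumpForm_le (hcone : UniformCone D E R δ) (hD : MeasurableSet D) (hR : 0 < R)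
    (hR1 : R ≤ 1) (hδ : 0 < δ) (hδ1 : δ ≤ 1) {c : ℝ≥0}
    (hc : ∀ u : Rd d → ℝ, Measurable u → ∀ B : ℝ≥0∞,
      (∀ k : Rd d, ‖k‖ ≤ δ * R → increment D u k ≤ B) → ∀ h : Rd d, increment D u h ≤ c * B)
    {α₀ α CU : ℝ} (hα₀ : 0 < α₀) (hα : α₀ ≤ α) (hα2 : α < 2) (hCU : 0 ≤ CU)
    {ν : Measure (Rd d)} (h0 : ν {0} = 0) (hν : UpperBound α CU ν)
    (hu : AEStronglyMeasurable u (volume.restrict D)) :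
    jumpForm ν D u ≤
      ((c + 1) * CU.toNNReal * (36 * E.card / δ ^ 2 *
        (4 * E.card / (volume.real (ball (0 : Rd d) 1) * δ ^ d))).toNNReal *
        (3 ^ (d + 2) / α₀).toNNReal : ℝ≥0) * kernelForm (muAlpha d α) D u := by
  have := hν.sigmaFinite h0
  obtain ⟨v, hv, huv⟩ := hu
  have hv' : Measurable v := hv.measurable
  rw [jumpForm_congr hD ν huv, kernelForm_muAlpha_congr α huv,
    jumpForm_eq_lintegral_increment hD hv' ν, kernelForm_muAlpha_eq hD hv']
  refine (hν.lintegral_le (R := δ * R) (Φ := shiftModulus D v) (c₁ := c + 1)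
    (c₂ := 36 * E.card / δ ^ 2)
    (c₃ := 4 * E.card / (volume.real (ball (0 : Rd d) 1) * δ ^ d)) hα₀ hα hα2 h0 hCU
    (by positivity) (mul_le_one₀ hδ1 hR.le hR1) (measurable_increment hD hv') increment_zero
    (by positivity) (by positivity) ?_ ?_ ?_).trans_eq ?_
  · intro h
    rcases le_total (δ * R) ‖h‖ with hh | hh
    · rw [min_eq_left hh]
      refine (hc v hv' _ (fun k hk => increment_le_shiftModulus hk) h).trans ?_
      gcongr
      exact le_self_add
    · rw [min_eq_right hh]
      refine (increment_le_shiftModulus le_rfl).trans ?_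
      push_cast
      exact le_mul_of_one_le_left zero_le le_add_self
  · exact fun s ρ hs hsρ hρ => hcone.shiftModulus_le hD hv' hδ hδ1 hs hsρ hρ
  · exact fun ρ hρ hρR => hcone.shiftModulus_le_average hD hv' hδ hδ1 hρ
      (hρR.trans (mul_le_of_le_one_left hR.le hδ1))
  · simp only [ENNReal.ofReal]
    push_cast
    ring

end Comparison

end NonlocalForms

theorem mainTheorem6 (d : ℕ) (α₀ CU : ℝ) (hα₀ : 0 < α₀) (hα₀' : α₀ < 2) (hCU : 0 < CU) :
    (∀ D : Set (NonlocalForms.Rd d), NonlocalForms.IsLipschitzDomain D → Bornology.IsBounded D →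
      ∃ c : ℝ≥0, ∀ α : ℝ, α₀ ≤ α → α < 2 →
        ∀ ν : Measure (NonlocalForms.Rd d), ν {0} = 0 → NonlocalForms.UpperBound α CU ν →
          ∀ u : NonlocalForms.Rd d → ℝ, NonlocalForms.MemH α D u →
            NonlocalForms.jumpForm ν D u ≤
              c * NonlocalForms.kernelForm (NonlocalForms.muAlpha d α) D u) ∧
    (∃ c : ℝ≥0, ∀ (x₀ : NonlocalForms.Rd d) (r : ℝ), 0 < r → r < 1 →
      ∀ α : ℝ, α₀ ≤ α → α < 2 →
        ∀ ν : Measure (NonlocalForms.Rd d), ν {0} = 0 → NonlocalForms.UpperBound α CU ν →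
          ∀ u : NonlocalForms.Rd d → ℝ, NonlocalForms.MemH α (Metric.ball x₀ r) u →
            NonlocalForms.jumpForm ν (Metric.ball x₀ r) u ≤
              c * NonlocalForms.kernelForm (NonlocalForms.muAlpha d α) (Metric.ball x₀ r) u) := by
  constructor
  · intro D hD hb
    obtain ⟨E, R, δ, hR, hR1, hδ, hδ1, hcone⟩ := hD.exists_uniformCone hb
    obtain ⟨c, hc⟩ := NonlocalForms.exists_increment_le_of_small hD.isOpen hD.isConnected hb
      (mul_pos hδ hR)
    exact ⟨_, fun α hα hα2 ν h0 hν u hu => hcone.jumpForm_le hD.isOpen.measurableSet hR hR1 hδ hδ1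
      hc hα₀ hα hα2 hCU.le h0 hν hu.1.aestronglyMeasurable⟩
  · obtain ⟨E, R, δ, hR, hR1, hδ, hδ1, hcone⟩ := NonlocalForms.exists_uniformCone_unitBall d
    -- shifts of length at most `2 r` are cut into `N` shifts of length at most `δ r R`
    obtain ⟨N, hN⟩ := exists_nat_ge (2 / (δ * R))
    have hN0 : (0 : ℝ) < N := lt_of_lt_of_le (by positivity) hN
    refine ⟨_, fun x₀ r hr hr1 α hα hα2 ν h0 hν u hu => (hcone.ball_of_unitBall x₀ hr).jumpForm_le
      (c := (N : ℝ≥0) ^ 2) measurableSet_ball (mul_pos hr hR) (mul_le_one₀ hr1.le hR.le hR1) hδ hδ1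
      ?_ hα₀ hα hα2 hCU.le h0 hν hu.1.aestronglyMeasurable⟩
    intro v hv B hB h
    rcases le_or_gt ‖h‖ (2 * r) with hh | hh
    · refine (NonlocalForms.increment_convex measurableSet_ball hv (convex_ball _ _)
        (Nat.cast_pos.1 hN0) h).trans ?_
      push_cast
      gcongr
      refine hB _ ?_
      rw [norm_smul, norm_inv, Real.norm_of_nonneg hN0.le, inv_mul_le_iff₀ hN0]
      rw [div_le_iff₀ (by positivity)] at hN
      nlinarith
    · have : ∀ x, NonlocalForms.sqDiff (Metric.ball x₀ r) v x (x + h) = 0 := by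
        intro x
        refine NonlocalForms.sqDiff_of_notMem fun hx => ?_
        have h1 := Metric.mem_ball'.1 hx.1
        have h2 := Metric.mem_ball.1 hx.2
        have h3 := dist_triangle (x + h) x₀ x
        rw [dist_eq_norm (x + h) x, add_sub_cancel_left] at h3
        linarith
      simp [NonlocalForms.increment, this]
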